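/- Let $W_2^1[0,1]$ be the Sobolev space of complex absolutely continuous functions with derivative in $L_2[0,1]$, normed by $\|y\|^2=\int_0^1(|y'|^2+|y|^2)\,dx$, and let $W_2^{-1}[0,1]$ be its dual space; $\int_0^1 fz\,dx$ denotes the pairing of $f\in W_2^{-1}[0,1]$ with $z\in W_2^1[0,1]$. For a diagonal unitary $2\times2$ matrix $U$ let $$\mathfrak H_U=\{y\in W_2^1[0,1] : y^\wedge\in\operatorname{im}(U-1)\},\qquad y^\wedge=\begin{pmatrix}y(0)\\y(1)\end{pmatrix},\quad y^\vee=\begin{pmatrix}y^{[1]}(0)\\-y^{[1]}(1)\end{pmatrix},$$ let $I:\mathfrak H_U\to L_2[0,1]$ be the embedding, $\mathfrak H_U'$ the completion of $L_2[0,1]$ in the norm $\|I^*f\|_{\mathfrak H_U}$, and $I^+:\mathfrak H_U'\to\mathfrak H_U$ the isometry extending $I^*$. The pencil $T:\mathfrak H_U\to\mathfrak H_U'$ of the problem $-(py')'+(q-\lambda r)y=0$, $(U-1)y^\vee+i(U+1)y^\wedge=0$ (where $y^{[1]}$ stands for $py'$) is defined by $$\langle I^+T(\lambda)y,y\rangle_{\mathfrak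 H_U}=\int_0^1p|y'|^2dx+\int_0^1(q-\lambda r)|y|^2dx+\langle Vy^\wedge,y^\wedge\rangle_{\mathbb C^2}\qquad(\lambda\in\mathbb C,\ y\in\mathfrak H_U),$$ where $V$ is diagonal with $V_{kk}=-\cot\frac{\arg U_{kk}}2$ if $U_{kk}\ne1$ and $V_{kk}=0$ if $U_{kk}=1$. Let $p\in L_\infty[0,1]$ be real and uniformly positive, $q,r\in W_2^{-1}[0,1]$, $\xi\in\mathbb R$, and let the real function $\omega\in L_2[0,1]$ and $\omega_1\in\mathbb R$ satisfy $$\int_0^1(q-\xi r)\bar y\,dx=-\int_0^1\omega\,\overline{y'}\,dx+\omega_1\overline{y(1)}\qquad\text{for all }y\in W_2^1[0,1].$$ Let $T$ be the pencil for the coefficients $p,q,r$ with one of the boundary conditions (a) $y(0)=y(1)=0$; (b) $y^{[1]}(0)=y(1)=0$; (c) $y^{[1]}(0)=y^{[1]}(1)=0$. Let $Y=(Y_1,Y_2)\in W_2^1[0,1]\times W_1^1[0,1]$ be real, with $Y_1$ uniformly positive on $[0,1]$, $\int_0^1Y_1^{-2}dx=1$, $$Y_1'=\frac{\omega}{p}Y_1+\frac1pY_2,\qquad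 Y_2'=-\frac{\omega^2}{p}Y_1-\frac{\omega}{p}Y_2 ,$$ and, in the cases (b) and (c), $Y_2(0)=0$. Put $\tau(t)=\int_0^t Y_1^{-2}dx$, let $J$ be the operator $[Jy](\tau(t))=y(t)$, let $J_\infty$ on $L_\infty[0,1]$ and $J_{-1}$ on $W_2^{-1}[0,1]$ be its extensions, and put $\hat p=J_\infty p$, $\hat r=J_{-1}(Y_1^4r)$, $Sy=J(y/Y_1)$. Let $\hat T$ be the pencil of the equation $-(\hat py')'-(\lambda-\xi)\hat ry=0$ with the same boundary conditions in the cases (a), (b), and in the case (c) with the boundary conditions $$y^{[1]}(0)=y^{[1]}(1)+\Bigl[\frac{Y_2(1)}{Y_1(1)}+\omega_1\Bigr]Y_1(1)^2\,y(1)=0,$$ where now $y^{[1]}=\hat py'$. Then $T$ and $\hat T$ are well defined and act in the same space $\mathfrak H_U$ (that is, the spaces $\mathfrak H$ of the two problems coincide), $S$ is a boundedly invertible operator $\mathfrak H_U\to\mathfrak H_U$, and $$S^*I^+\hat T(\lambda)S=I^+T(\lambda)\qquad\text{for all }\lambda\in\mathbb C .$$ -/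

import Mathlib

open MeasureTheory Set Filter Topology
open scoped ENNReal ComplexConjugate

noncomputable section
namespace SturmLiouville

/-- Lebesgue measure on `[0,1]`. -/
abbrev μI : Measure ℝ := volume.restrict (Icc 0 1)

/-- The complex Hilbert space `L₂[0,1]`. -/
abbrev L2I : Type := Lp ℂ 2 μI

theorem intervalIntegrable_of_integrable {g : ℝ → ℂ} (hg : Integrable g μI) {a b : ℝ}
    (ha : a ∈ Icc (0 : ℝ) 1) (hb : b ∈ Icc (0 : ℝ) 1) : IntervalIntegrable g volume a b := by
  rw [intervalIntegrable_iff]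
  refine IntegrableOn.mono_set (t := Icc (0 : ℝ) 1) hg ?_
  intro x hx
  rw [mem_uIoc] at hx
  rcases hx with hx | hx
  · exact ⟨ha.1.trans hx.1.le, hx.2.trans hb.2⟩
  · exact ⟨hb.1.trans hx.1.le, hx.2.trans ha.2⟩

theorem integral_congr_of_ae {g h : ℝ → ℂ} (hgh : g =ᵐ[μI] h) {t : ℝ}
    (ht : t ∈ Icc (0 : ℝ) 1) : ∫ x in (0 : ℝ)..t, g x = ∫ x in (0 : ℝ)..t, h x := by
  apply intervalIntegral.integral_congr_ae
  have := (ae_restrict_iff' measurableSet_Icc).1 hgh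
  filter_upwards [this] with x hx hxt
  rw [uIoc_of_le ht.1] at hxt
  exact hx ⟨hxt.1.le, hxt.2.trans ht.2⟩

theorem integrable_of_memLp_two {g : ℝ → ℂ} (hg : MemLp g 2 μI) : Integrable g μI :=
  hg.integrable (by norm_num)

theorem integrable_L2 (g : L2I) : Integrable g μI := integrable_of_memLp_two (Lp.memLp g)

/-- Pairs `(y, y')` where `y` is continuous on `[0,1]`, `y' ∈ L₂[0,1]` and
`y(t) = y(0) + ∫₀ᵗ y'` for all `t`. -/
def w21Submodule : Submodule ℂ (C(unitInterval, ℂ) × L2I) where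
  carrier := {y | ∀ t : unitInterval, y.1 t = y.1 0 + ∫ x in (0 : ℝ)..t, y.2 x}
  add_mem' := by
    intro y z hy hz t
    have h0 : (0 : ℝ) ∈ Icc (0 : ℝ) 1 := by simp
    have e : ∫ x in (0 : ℝ)..t, (y.2 + z.2) x
        = (∫ x in (0 : ℝ)..t, y.2 x) + ∫ x in (0 : ℝ)..t, z.2 x := by
      rw [integral_congr_of_ae (Lp.coeFn_add y.2 z.2) t.2]
      exact intervalIntegral.integral_add
        (intervalIntegrable_of_integrable (integrable_L2 _) h0 t.2)
        (intervalIntegrable_of_integrable (integrable_L2 _) h0 t.2)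
    have h1 := hy t
    have h2 := hz t
    simp only [Prod.fst_add, Prod.snd_add, ContinuousMap.add_apply, e, h1, h2]
    ring
  zero_mem' := by
    intro t
    have e : ∫ x in (0 : ℝ)..t, (0 : L2I) x = 0 := by
      rw [integral_congr_of_ae (Lp.coeFn_zero ℂ 2 μI) t.2]
      simp
    show (0 : ℂ) = 0 + ∫ x in (0 : ℝ)..t, (0 : L2I) x
    rw [e, add_zero]
  smul_mem' := by
    intro c y hy t
    have e : ∫ x in (0 : ℝ)..t, (c • y.2) x = c * ∫ x in (0 : ℝ)..t, y.2 x := by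
      rw [integral_congr_of_ae (Lp.coeFn_smul c y.2) t.2]
      simp
    have h1 := hy t
    simp only [Prod.smul_fst, Prod.smul_snd, ContinuousMap.smul_apply, e, h1, smul_eq_mul]
    ring

/-- The Sobolev space `W₂¹[0,1]` of complex functions: absolutely continuous functions on `[0,1]`
with square integrable derivative. -/
def W21 : Type := ↥w21Submodule

namespace W21

instance : AddCommGroup W21 := inferInstanceAs (AddCommGroup ↥w21Submodule)
instance : Module ℂ W21 := inferInstanceAs (Module ℂ ↥w21Submodule)

/-- The derivative `y' ∈ L₂[0,1]`. -/
def deriv (y : W21) : L2I := y.1.2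

/-- Values of `y ∈ W₂¹[0,1]` (extended to `ℝ` by constants outside `[0,1]`). -/
def eval (y : W21) (t : ℝ) : ℂ := y.1.1 (projIcc 0 1 zero_le_one t)

instance : CoeFun W21 (fun _ => ℝ → ℂ) := ⟨eval⟩

theorem apply_eq (y : W21) {t : ℝ} (ht : t ∈ Icc (0 : ℝ) 1) :
    y t = y 0 + ∫ x in (0 : ℝ)..t, y.deriv x := by
  have := y.2 ⟨t, ht⟩
  have e0 : projIcc (0 : ℝ) 1 zero_le_one 0 = 0 := projIcc_left _
  show y.1.1 (projIcc 0 1 zero_le_one t) = y.1.1 (projIcc 0 1 zero_le_one 0) + _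
  rw [projIcc_of_mem zero_le_one ht, e0]
  exact this

theorem continuous_coe (y : W21) : Continuous (fun t => y t) :=
  y.1.1.continuous.comp continuous_projIcc

@[simp] theorem add_apply (y z : W21) (t : ℝ) : (y + z) t = y t + z t := rfl
@[simp] theorem smul_apply (c : ℂ) (y : W21) (t : ℝ) : (c • y) t = c * y t := rfl
@[simp] theorem deriv_add (y z : W21) : (y + z).deriv = y.deriv + z.deriv := rfl
@[simp] theorem deriv_smul (c : ℂ) (y : W21) : (c • y).deriv = c • y.deriv := rfl

/-- The element of `W₂¹[0,1]` given by a function `f` with derivative `g ∈ L₂[0,1]`. -/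
def mk (f g : ℝ → ℂ) (hg : MemLp g 2 μI)
    (h : ∀ t ∈ Icc (0 : ℝ) 1, f t = f 0 + ∫ x in (0 : ℝ)..t, g x) : W21 :=
  ⟨(⟨fun t : unitInterval => f t, by
      have h0 : (0 : ℝ) ∈ Icc (0 : ℝ) 1 := by simp
      have h1 : (1 : ℝ) ∈ Icc (0 : ℝ) 1 := by simp
      have c : ContinuousOn (fun t : ℝ => ∫ x in (0 : ℝ)..t, g x) (uIcc 0 1) :=
        intervalIntegral.continuousOn_primitive_interval (by
          rw [uIcc_of_le zero_le_one]; exact integrable_of_memLp_two hg)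
      rw [uIcc_of_le zero_le_one] at c
      have c2 : ContinuousOn f (Icc 0 1) :=
        (continuousOn_const.add c).congr (fun t ht => h t ht)
      exact continuousOn_iff_continuous_domRestrict.1 c2⟩, hg.toLp g), by
    intro t
    show f t = f 0 + ∫ x in (0 : ℝ)..t, hg.toLp g x
    rw [integral_congr_of_ae hg.coeFn_toLp t.2]
    exact h t t.2⟩

theorem mk_apply {f g : ℝ → ℂ} (hg : MemLp g 2 μI)
    (h : ∀ t ∈ Icc (0 : ℝ) 1, f t = f 0 + ∫ x in (0 : ℝ)..t, g x) {t : ℝ}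
    (ht : t ∈ Icc (0 : ℝ) 1) : mk f g hg h t = f t := by
  show f (projIcc (0 : ℝ) 1 zero_le_one t) = f t
  rw [projIcc_of_mem zero_le_one ht]

theorem deriv_mk {f g : ℝ → ℂ} (hg : MemLp g 2 μI)
    (h : ∀ t ∈ Icc (0 : ℝ) 1, f t = f 0 + ∫ x in (0 : ℝ)..t, g x) :
    (mk f g hg h).deriv =ᵐ[μI] g := hg.coeFn_toLp

theorem ae_hasDerivAt (y : W21) :
    ∀ᵐ t ∂μI, HasDerivAt (fun t => y t) (y.deriv t) t := by
  have h0 : (0 : ℝ) ∈ Icc (0 : ℝ) 1 := by simp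
  have h1 : (1 : ℝ) ∈ Icc (0 : ℝ) 1 := by simp
  have hi := intervalIntegrable_of_integrable (integrable_L2 y.deriv) h0 h1
  have key := hi.ae_hasDerivAt_integral
  have : ∀ᵐ t : ℝ, t ≠ 0 ∧ t ≠ 1 := by
    have a : ∀ᵐ t : ℝ, t ≠ 0 := by simp [ae_iff, measure_singleton]
    have b : ∀ᵐ t : ℝ, t ≠ 1 := by simp [ae_iff, measure_singleton]
    filter_upwards [a, b] with t ha hb using ⟨ha, hb⟩
  rw [ae_restrict_iff' measurableSet_Icc]
  filter_upwards [key, this] with t ht hne htI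
  rw [uIcc_of_le zero_le_one] at ht
  have hd := (ht htI 0 h0).const_add (y 0)
  refine hd.congr_of_eventuallyEq ?_
  have : Ioo (0 : ℝ) 1 ∈ 𝓝 t :=
    Ioo_mem_nhds (lt_of_le_of_ne htI.1 (Ne.symm hne.1)) (lt_of_le_of_ne htI.2 hne.2)
  filter_upwards [this] with s hs
  exact y.apply_eq ⟨hs.1.le, hs.2.le⟩

theorem ext {y z : W21} (h : ∀ t ∈ Icc (0 : ℝ) 1, y t = z t) : y = z := by
  have e : y.deriv = z.deriv := by
    apply Lp.ext
    have hne : ∀ᵐ t ∂μI, t ≠ 0 ∧ t ≠ 1 := by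
      apply ae_restrict_of_ae
      have a : ∀ᵐ t : ℝ, t ≠ 0 := by simp [ae_iff, measure_singleton]
      have b : ∀ᵐ t : ℝ, t ≠ 1 := by simp [ae_iff, measure_singleton]
      filter_upwards [a, b] with t ha hb using ⟨ha, hb⟩
    filter_upwards [y.ae_hasDerivAt, z.ae_hasDerivAt, hne, ae_restrict_mem measurableSet_Icc]
      with t hy hz hn htI
    refine hy.unique (hz.congr_of_eventuallyEq ?_)
    have : Ioo (0 : ℝ) 1 ∈ 𝓝 t :=
      Ioo_mem_nhds (lt_of_le_of_ne htI.1 (Ne.symm hn.1)) (lt_of_le_of_ne htI.2 hn.2)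
    filter_upwards [this] with s hs
    exact h s ⟨hs.1.le, hs.2.le⟩
  apply Subtype.ext
  apply Prod.ext
  · ext t
    have := h t t.2
    simpa [eval] using this
  · exact e

theorem memLp_coe (y : W21) (p : ℝ≥0∞) : MemLp (fun t => y t) p μI := by
  obtain ⟨C, hC⟩ := isCompact_Icc.exists_bound_of_continuousOn
    (y.continuous_coe.continuousOn (s := Icc (0 : ℝ) 1))
  refine MemLp.of_bound y.continuous_coe.aestronglyMeasurable C ?_
  filter_upwards [ae_restrict_mem measurableSet_Icc] with t ht using hC t ht

/-- The embedding `W₂¹[0,1] → L₂[0,1]`. -/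
def toL2 : W21 →ₗ[ℂ] L2I where
  toFun y := (y.memLp_coe 2).toLp (fun t => y t)
  map_add' y z := MemLp.toLp_add (y.memLp_coe 2) (z.memLp_coe 2)
  map_smul' c y := MemLp.toLp_const_smul c (y.memLp_coe 2)

/-- The inner product `∫₀¹ (y' z̄' + y z̄) dx` (linear in the second argument, following Mathlib). -/
@[reducible] def innerCore : InnerProductSpace.Core ℂ W21 where
  inner y z := inner ℂ y.deriv z.deriv + inner ℂ (toL2 y) (toL2 z)
  conj_inner_symm y z := by simp [inner_conj_symm]
  re_inner_nonneg y := by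
    have h1 := inner_self_nonneg (𝕜 := ℂ) (x := y.deriv)
    have h2 := inner_self_nonneg (𝕜 := ℂ) (x := toL2 y)
    simp only [map_add]
    positivity
  add_left x y z := by
    simp only [deriv_add, map_add, inner_add_left]; ring
  smul_left x y c := by
    simp only [deriv_smul, map_smul, inner_smul_left]; ring
  definite y hy := by
    have h1 := inner_self_nonneg (𝕜 := ℂ) (x := y.deriv)
    have h2 := inner_self_nonneg (𝕜 := ℂ) (x := toL2 y)
    have h3 : RCLike.re (inner ℂ y.deriv y.deriv) + RCLike.re (inner ℂ (toL2 y) (toL2 y)) = 0 := by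
      rw [← map_add, hy, map_zero]
    have h4 : RCLike.re (inner ℂ (y.deriv) (y.deriv)) = 0 := by linarith
    have h5 : RCLike.re (inner ℂ (toL2 y) (toL2 y)) = 0 := by linarith
    have d : y.deriv = 0 := by
      rw [inner_self_eq_norm_sq] at h4; simpa using h4
    have f : toL2 y = 0 := by
      rw [inner_self_eq_norm_sq] at h5; simpa using h5
    have c : ∀ t ∈ Icc (0 : ℝ) 1, y t = y 0 := by
      intro t ht
      rw [y.apply_eq ht, d, integral_congr_of_ae (Lp.coeFn_zero ℂ 2 μI) ht]
      simp
    have ae0 : ∀ᵐ t ∂μI, y 0 = 0 := by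
      have a1 : (toL2 y : ℝ → ℂ) =ᵐ[μI] fun t => y t := (y.memLp_coe 2).coeFn_toLp
      rw [f] at a1
      filter_upwards [a1, Lp.coeFn_zero ℂ 2 μI, ae_restrict_mem measurableSet_Icc]
        with t ht ht2 htI
      rw [← c t htI, ← ht, ht2]; rfl
    have y0 : y 0 = 0 := by
      have : NeZero μI := ⟨by
        intro h
        have := congrArg (fun m : Measure ℝ => m univ) h
        simp at this⟩
      exact ae0.exists.choose_spec
    apply ext
    intro t ht
    rw [c t ht, y0]
    rfl

instance : NormedAddCommGroup W21 := innerCore.toNormedAddCommGroup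
instance : InnerProductSpace ℂ W21 := InnerProductSpace.ofCore innerCore.toCore

theorem inner_def (y z : W21) :
    inner ℂ y z = inner ℂ y.deriv z.deriv + inner ℂ (toL2 y) (toL2 z) := rfl


theorem norm_sq_eq (y : W21) : ‖y‖ ^ 2 = ‖y.deriv‖ ^ 2 + ‖toL2 y‖ ^ 2 := by
  have h := inner_def y y
  rw [inner_self_eq_norm_sq_to_K, inner_self_eq_norm_sq_to_K, inner_self_eq_norm_sq_to_K] at h
  exact_mod_cast h

theorem norm_deriv_le (y : W21) : ‖y.deriv‖ ≤ ‖y‖ := by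
  have := norm_sq_eq y
  exact abs_le_of_sq_le_sq' (by nlinarith [sq_nonneg ‖toL2 y‖]) (norm_nonneg _) |>.2

theorem norm_toL2_le (y : W21) : ‖toL2 y‖ ≤ ‖y‖ := by
  have := norm_sq_eq y
  exact abs_le_of_sq_le_sq' (by nlinarith [sq_nonneg ‖y.deriv‖]) (norm_nonneg _) |>.2

theorem integral_norm_le (g : L2I) : ∫ x, ‖g x‖ ∂μI ≤ ‖g‖ := by
  have : IsProbabilityMeasure μI := ⟨by simp⟩
  rw [integral_norm_eq_lintegral_enorm (Lp.aestronglyMeasurable g), Lp.norm_def,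
    ← eLpNorm_one_eq_lintegral_enorm]
  exact ENNReal.toReal_mono (Lp.eLpNorm_ne_top g)
    (eLpNorm_le_eLpNorm_of_exponent_le (by norm_num) (Lp.aestronglyMeasurable g))

theorem norm_integral_le (g : L2I) {t : ℝ} (ht : t ∈ Icc (0 : ℝ) 1) :
    ‖∫ x in (0 : ℝ)..t, g x‖ ≤ ‖g‖ := by
  refine le_trans (intervalIntegral.norm_integral_le_integral_norm ht.1) ?_
  refine le_trans ?_ (integral_norm_le g)
  rw [intervalIntegral.integral_of_le ht.1]
  refine setIntegral_mono_set (integrable_L2 g).norm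
    (Eventually.of_forall fun x => norm_nonneg _) ?_
  exact (show Ioc 0 t ⊆ Icc 0 1 from fun x hx => ⟨hx.1.le, hx.2.trans ht.2⟩).eventuallyLE

theorem norm_eval_zero_le (y : W21) : ‖y 0‖ ≤ 2 * ‖y‖ := by
  have : IsProbabilityMeasure μI := ⟨by simp⟩
  have e : (toL2 y : ℝ → ℂ) =ᵐ[μI] fun t => y t := (y.memLp_coe 2).coeFn_toLp
  have h : ∀ᵐ s ∂μI, ‖y 0‖ - ‖y.deriv‖ ≤ ‖toL2 y s‖ := by
    filter_upwards [e, ae_restrict_mem measurableSet_Icc] with s hs hsI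
    have h1 := norm_integral_le y.deriv hsI
    have h2 : y 0 = y s - ∫ x in (0 : ℝ)..s, y.deriv x := by rw [y.apply_eq hsI]; ring
    have h3 := norm_sub_le (y s) (∫ x in (0 : ℝ)..s, y.deriv x)
    rw [← h2] at h3
    rw [hs]
    linarith
  have h4 : ‖y 0‖ - ‖y.deriv‖ ≤ ∫ s, ‖toL2 y s‖ ∂μI := by
    have := integral_mono_ae (μ := μI) (integrable_const (‖y 0‖ - ‖y.deriv‖))
      (integrable_L2 (toL2 y)).norm h
    simpa using this
  have h5 := integral_norm_le (toL2 y)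
  have h6 := norm_deriv_le y
  have h7 := norm_toL2_le y
  linarith

theorem norm_eval_le (y : W21) {t : ℝ} (ht : t ∈ Icc (0 : ℝ) 1) : ‖y t‖ ≤ 3 * ‖y‖ := by
  rw [y.apply_eq ht]
  have h1 := norm_add_le (y 0) (∫ x in (0 : ℝ)..t, y.deriv x)
  have h2 := norm_integral_le y.deriv ht
  have h3 := norm_eval_zero_le y
  have h4 := norm_deriv_le y
  linarith

theorem norm_le_eval_zero_add (y : W21) : ‖y‖ ≤ 2 * (‖y 0‖ + ‖y.deriv‖) := by
  have e : (toL2 y : ℝ → ℂ) =ᵐ[μI] fun t => y t := (y.memLp_coe 2).coeFn_toLp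
  have hb : ‖toL2 y‖ ≤ ‖y 0‖ + ‖y.deriv‖ := by
    have : IsProbabilityMeasure μI := ⟨by simp⟩
    have := Lp.norm_le_of_ae_bound (f := toL2 y) (C := ‖y 0‖ + ‖y.deriv‖) (by positivity) (by
      filter_upwards [e, ae_restrict_mem measurableSet_Icc] with s hs hsI
      rw [hs, y.apply_eq hsI]
      exact (norm_add_le _ _).trans (by gcongr; exact norm_integral_le _ hsI))
    simpa [measureUnivNNReal] using this
  have h := norm_sq_eq y
  have h0 := norm_nonneg (y 0)
  have h1 := norm_nonneg y.deriv
  have h2 := norm_nonneg (toL2 y)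
  exact abs_le_of_sq_le_sq' (by nlinarith) (by positivity) |>.2

/-- Differentiation as a bounded operator `W₂¹[0,1] → L₂[0,1]`. -/
def derivL : W21 →L[ℂ] L2I :=
  LinearMap.mkContinuous { toFun := deriv, map_add' := deriv_add, map_smul' := deriv_smul } 1
    (fun y => by simpa using norm_deriv_le y)

/-- The embedding `W₂¹[0,1] → L₂[0,1]` as a bounded operator. -/
def toL2L : W21 →L[ℂ] L2I :=
  LinearMap.mkContinuous toL2 1 (fun y => by simpa using norm_toL2_le y)

/-- Evaluation at a point as a bounded functional. -/
def evalL (t : ℝ) : W21 →L[ℂ] ℂ :=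
  LinearMap.mkContinuous
    { toFun := fun y => y t, map_add' := fun _ _ => rfl, map_smul' := fun _ _ => rfl } 3
    (fun y => by
      have : y t = y (projIcc 0 1 zero_le_one t : ℝ) := by simp [eval]
      show ‖y t‖ ≤ _
      rw [this]
      exact norm_eval_le y (projIcc (0 : ℝ) 1 zero_le_one t).2)

@[simp] theorem evalL_apply (t : ℝ) (y : W21) : evalL t y = y t := rfl
@[simp] theorem derivL_apply (y : W21) : derivL y = y.deriv := rfl
@[simp] theorem toL2L_apply (y : W21) : toL2L y = toL2 y := rfl

instance : CompleteSpace W21 := by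
  refine Metric.complete_of_cauchySeq_tendsto fun u hu => ?_
  obtain ⟨g, hg⟩ := cauchySeq_tendsto_of_complete (derivL.uniformContinuous.comp_cauchySeq hu)
  obtain ⟨c, hc⟩ := cauchySeq_tendsto_of_complete ((evalL 0).uniformContinuous.comp_cauchySeq hu)
  let y : W21 := mk (fun t => c + ∫ x in (0 : ℝ)..t, g x) g (Lp.memLp g) (by intro t _; simp)
  have y0 : y 0 = c := by
    rw [mk_apply _ _ (by simp)]; simp
  have yd : y.deriv = g := Lp.ext (deriv_mk _ _)
  refine ⟨y, ?_⟩
  rw [tendsto_iff_norm_sub_tendsto_zero] at hg hc ⊢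
  have hs := ((hc.add hg).const_mul 2)
  simp only [add_zero, mul_zero] at hs
  refine squeeze_zero (fun n => norm_nonneg _) (fun n => ?_) hs
  refine (norm_le_eval_zero_add _).trans (le_of_eq ?_)
  rw [← evalL_apply, ← derivL_apply, map_sub, map_sub, evalL_apply 0 y, derivL_apply y, y0, yd]
  rfl

/-- A linear map of `W₂¹[0,1]` into itself whose point values depend continuously on the argument
is bounded (closed graph theorem). -/
theorem continuous_of_eval (L : W21 →ₗ[ℂ] W21)
    (h : ∀ t ∈ Icc (0 : ℝ) 1, Continuous fun y => (L y) t) : Continuous L := by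
  refine L.continuous_of_seq_closed_graph fun u x y hu hLu => ?_
  apply ext
  intro t ht
  have h1 : Tendsto (fun n => (L (u n)) t) atTop (𝓝 (y t)) :=
    ((evalL t).continuous.tendsto y).comp hLu
  have h2 : Tendsto (fun n => (L (u n)) t) atTop (𝓝 ((L x) t)) :=
    ((h t ht).tendsto x).comp hu
  exact tendsto_nhds_unique h1 h2

/-! ### Multiplication, conjugation, reciprocals -/

theorem absCont_of_dist_le {f h : ℝ → ℂ} {K : ℝ} (hK : 0 ≤ K)
    (hf : AbsolutelyContinuousOnInterval f 0 1)
    (hd : ∀ a ∈ Icc (0 : ℝ) 1, ∀ b ∈ Icc (0 : ℝ) 1, dist (h a) (h b) ≤ K * dist (f a) (f b)) :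
    AbsolutelyContinuousOnInterval h 0 1 := by
  rw [absolutelyContinuousOnInterval_iff] at hf ⊢
  intro ε hε
  obtain ⟨δ, hδ, H⟩ := hf (ε / (K + 1)) (by positivity)
  refine ⟨δ, hδ, fun E hE hs => ?_⟩
  have h1 := H E hE hs
  have h2 : ∑ i ∈ Finset.range E.1, dist (h (E.2 i).1) (h (E.2 i).2)
      ≤ (K + 1) * ∑ i ∈ Finset.range E.1, dist (f (E.2 i).1) (f (E.2 i).2) := by
    rw [Finset.mul_sum]
    refine Finset.sum_le_sum fun i hi => ?_
    have hm := hE.1 i hi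
    rw [uIcc_of_le zero_le_one] at hm
    refine (hd _ hm.1 _ hm.2).trans ?_
    gcongr
    linarith
  calc _ ≤ _ := h2
    _ < (K + 1) * (ε / (K + 1)) := by gcongr
    _ = ε := by field_simp

theorem absCont_primitive {g : ℝ → ℂ} (hg : Integrable g μI) :
    AbsolutelyContinuousOnInterval (fun t => ∫ x in (0 : ℝ)..t, g x) 0 1 := by
  have h0 : (0 : ℝ) ∈ Icc (0 : ℝ) 1 := by simp
  have h1 : (1 : ℝ) ∈ Icc (0 : ℝ) 1 := by simp
  have hn : IntervalIntegrable (fun x => ‖g x‖) volume 0 1 :=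
    (intervalIntegrable_of_integrable hg h0 h1).norm
  have hG := hn.absolutelyContinuousOnInterval_intervalIntegral (c := 0) (by simp)
  rw [absolutelyContinuousOnInterval_iff] at hG ⊢
  intro ε hε
  obtain ⟨δ, hδ, H⟩ := hG ε hε
  refine ⟨δ, hδ, fun E hE hs => lt_of_le_of_lt (Finset.sum_le_sum fun i hi => ?_) (H E hE hs)⟩
  have hm := hE.1 i hi
  rw [uIcc_of_le zero_le_one] at hm
  have ia := intervalIntegrable_of_integrable hg h0 hm.1
  have ib := intervalIntegrable_of_integrable hg h0 hm.2
  rw [dist_eq_norm, dist_eq_norm, intervalIntegral.integral_interval_sub_left ia ib,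
    intervalIntegral.integral_interval_sub_left ia.norm ib.norm]
  exact intervalIntegral.norm_integral_le_abs_integral_norm

theorem absCont (y : W21) : AbsolutelyContinuousOnInterval (fun t => y t) 0 1 := by
  refine absCont_of_dist_le zero_le_one (absCont_primitive (integrable_L2 y.deriv)) ?_
  intro a ha b hb
  rw [y.apply_eq ha, y.apply_eq hb, dist_add_left, one_mul]

/-- Newton–Leibniz formula for absolutely continuous functions. -/
theorem eq_add_integral {f g : ℝ → ℂ} (hf : AbsolutelyContinuousOnInterval f 0 1)
    (hg : Integrable g μI) (h : ∀ᵐ t ∂μI, HasDerivAt f (g t) t) :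
    ∀ t ∈ Icc (0 : ℝ) 1, f t = f 0 + ∫ x in (0 : ℝ)..t, g x := by
  have h0 : (0 : ℝ) ∈ Icc (0 : ℝ) 1 := by simp
  have h1 : (1 : ℝ) ∈ Icc (0 : ℝ) 1 := by simp
  have hi := intervalIntegrable_of_integrable hg h0 h1
  obtain ⟨C, hC⟩ := (hf.sub (absCont_primitive hg)).const_of_ae_hasDerivAt_zero (by
    rw [ae_restrict_iff' measurableSet_Icc] at h
    filter_upwards [hi.ae_hasDerivAt_integral, h] with x hx1 hx2 hx
    rw [uIcc_of_le zero_le_one] at hx1 hx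
    have := (hx2 hx).sub (hx1 hx 0 h0)
    rw [sub_self] at this
    exact this)
  rw [uIcc_of_le zero_le_one] at hC
  intro t ht
  have e0 := hC 0 h0
  have et := hC t ht
  simp only [Pi.sub_apply, intervalIntegral.integral_same, sub_zero] at e0 et
  rw [e0, ← et]; ring

theorem memLp_mul_deriv (a y : W21) : MemLp (fun t => a t * y.deriv t) 2 μI :=
  (Lp.memLp y.deriv).mul' (a.memLp_coe ∞)

/-- The product of two functions from `W₂¹[0,1]`. -/
def mul (a y : W21) : W21 :=
  mk (fun t => a t * y t) (fun t => y t * a.deriv t + a t * y.deriv t)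
    ((memLp_mul_deriv y a).add (memLp_mul_deriv a y))
    (eq_add_integral (a.absCont.smul y.absCont)
      (integrable_of_memLp_two ((memLp_mul_deriv y a).add (memLp_mul_deriv a y))) (by
        filter_upwards [a.ae_hasDerivAt, y.ae_hasDerivAt] with t ha hy
        have := ha.mul hy
        rw [mul_comm (a.deriv t)] at this
        exact this))

theorem mul_apply (a y : W21) {t : ℝ} (ht : t ∈ Icc (0 : ℝ) 1) : mul a y t = a t * y t :=
  mk_apply _ _ ht

/-- The complex conjugate of a function from `W₂¹[0,1]`. -/
def conjugate (y : W21) : W21 :=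
  mk (fun t => starRingEnd ℂ (y t)) (fun t => starRingEnd ℂ (y.deriv t))
    (Lp.memLp y.deriv).star
    (eq_add_integral
      (absCont_of_dist_le zero_le_one y.absCont (fun a _ b _ => by
        rw [dist_eq_norm, ← map_sub, RCLike.norm_conj, one_mul, dist_eq_norm]))
      (integrable_of_memLp_two (Lp.memLp y.deriv).star) (by
        filter_upwards [y.ae_hasDerivAt] with t hy
        exact hy.star))

theorem conjugate_apply (y : W21) {t : ℝ} (ht : t ∈ Icc (0 : ℝ) 1) :
    conjugate y t = starRingEnd ℂ (y t) := mk_apply _ _ ht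

/-- Multiplication by a function from `W₂¹[0,1]` as a bounded operator in `W₂¹[0,1]`. -/
def mulL (a : W21) : W21 →L[ℂ] W21 where
  toFun y := mul a y
  map_add' y z := ext fun t ht => by
    rw [add_apply, mul_apply a _ ht, mul_apply a _ ht, mul_apply a _ ht, add_apply]; ring
  map_smul' c y := ext fun t ht => by
    rw [RingHom.id_apply, smul_apply, mul_apply a _ ht, mul_apply a _ ht, smul_apply]; ring
  cont := continuous_of_eval
    { toFun := fun y => mul a y
      map_add' := fun y z => ext fun t ht => by
        rw [add_apply, mul_apply a _ ht, mul_apply a _ ht, mul_apply a _ ht, add_apply]; ring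
      map_smul' := fun c y => ext fun t ht => by
        rw [RingHom.id_apply, smul_apply, mul_apply a _ ht, mul_apply a _ ht, smul_apply]; ring }
    (fun t ht => by
      have : (fun y : W21 => mul a y t) = fun y => a t * evalL t y := by
        funext y; rw [mul_apply a y ht]; rfl
      show Continuous (fun y : W21 => mul a y t)
      rw [this]
      exact continuous_const.mul (evalL t).continuous)

/-- Natural powers of a function from `W₂¹[0,1]`. -/
instance : Pow W21 ℕ :=
  ⟨fun a n => n.rec (mk (fun _ => 1) (fun _ => 0) MemLp.zero (fun t _ => by simp))
    (fun _ b => mul b a)⟩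

theorem pow_apply (a : W21) (n : ℕ) {t : ℝ} (ht : t ∈ Icc (0 : ℝ) 1) : (a ^ n) t = a t ^ n := by
  induction n with
  | zero => rw [pow_zero]; exact mk_apply _ _ ht
  | succ n ih => rw [pow_succ, ← ih]; exact mul_apply _ a ht

end W21

/-- `W₂⁻¹[0,1]`, the dual space of `W₂¹[0,1]`; the value `f z` is the pairing `∫₀¹ f·z dx`. -/
abbrev WNeg : Type := StrongDual ℂ W21

/-- The functional `z ↦ ∫₀¹ f z dx` defined by a function `f ∈ L₂[0,1]`. -/
def WNeg.ofL2 (f : L2I) : WNeg :=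
  (innerSL ℂ (star f : L2I)).comp W21.toL2L

/-- The product of a function `a ∈ W₂¹[0,1]` and a generalized function `f ∈ W₂⁻¹[0,1]`. -/
def WNeg.mul (a : W21) (f : WNeg) : WNeg := f.comp (W21.mulL a)


/-- A real, uniformly positive function `Y₁ ∈ W₂¹[0,1]` with `∫₀¹ dx / Y₁² = 1`. -/
structure PositiveFactor where
  toW21 : W21
  im_eq_zero : ∀ t ∈ Icc (0 : ℝ) 1, (toW21 t).im = 0
  unif_pos : ∃ c : ℝ, 0 < c ∧ ∀ t ∈ Icc (0 : ℝ) 1, c ≤ (toW21 t).re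
  integral_eq_one : ∫ x in (0 : ℝ)..1, 1 / (toW21 x).re ^ 2 = 1

namespace PositiveFactor

variable (Y : PositiveFactor)

/-- The real values of `Y₁`. -/
def val (t : ℝ) : ℝ := (Y.toW21 t).re

theorem continuous_val : Continuous Y.val := Complex.continuous_re.comp Y.toW21.continuous_coe

theorem exists_pos_le : ∃ c : ℝ, 0 < c ∧ ∀ t, c ≤ Y.val t := by
  obtain ⟨c, hc, h⟩ := Y.unif_pos
  refine ⟨c, hc, fun t => ?_⟩
  have e : Y.val t = (Y.toW21 (projIcc (0 : ℝ) 1 zero_le_one t : ℝ)).re := by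
    simp [val, W21.eval]
  rw [e]
  exact h _ (projIcc (0 : ℝ) 1 zero_le_one t).2

theorem val_pos (t : ℝ) : 0 < Y.val t := by
  obtain ⟨c, hc, h⟩ := Y.exists_pos_le
  exact hc.trans_le (h t)

theorem toW21_eq {t : ℝ} (ht : t ∈ Icc (0 : ℝ) 1) : Y.toW21 t = (Y.val t : ℂ) := by
  apply Complex.ext
  · rfl
  · simpa using Y.im_eq_zero t ht

theorem toW21_ne_zero {t : ℝ} (ht : t ∈ Icc (0 : ℝ) 1) : Y.toW21 t ≠ 0 := by
  rw [Y.toW21_eq ht]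
  exact_mod_cast (Y.val_pos t).ne'

theorem memLp_inv : MemLp (fun t => -((((Y.val t)⁻¹ : ℝ) : ℂ) ^ 2) * Y.toW21.deriv t) 2 μI := by
  obtain ⟨c, hc, h⟩ := Y.exists_pos_le
  refine (Lp.memLp Y.toW21.deriv).mul' (r := 2) (p := ∞) (MemLp.of_bound
    (by
      have := Y.continuous_val.inv₀ (fun t => (Y.val_pos t).ne')
      have : Continuous fun t => -((((Y.val t)⁻¹ : ℝ) : ℂ) ^ 2) :=
        ((Complex.continuous_ofReal.comp this).pow 2).neg
      exact this.aestronglyMeasurable) (c⁻¹ ^ 2) (Eventually.of_forall fun t => ?_))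
  have h1 : (Y.val t)⁻¹ ≤ c⁻¹ := inv_anti₀ hc (h t)
  have h2 : 0 ≤ (Y.val t)⁻¹ := (inv_pos.2 (Y.val_pos t)).le
  rw [norm_neg, norm_pow, Complex.norm_real, Real.norm_of_nonneg h2]
  gcongr

/-- The function `1 / Y₁ ∈ W₂¹[0,1]`. -/
def inv : W21 :=
  W21.mk (fun t => (Y.toW21 t)⁻¹) (fun t => -((((Y.val t)⁻¹ : ℝ) : ℂ) ^ 2) * Y.toW21.deriv t)
    Y.memLp_inv
    (W21.eq_add_integral (by
      obtain ⟨c, hc, h⟩ := Y.exists_pos_le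
      refine W21.absCont_of_dist_le (K := c⁻¹ * c⁻¹) (by positivity) Y.toW21.absCont
        fun a ha b hb => ?_
      have na := Y.toW21_ne_zero ha
      have nb := Y.toW21_ne_zero hb
      have ea : ‖(Y.toW21 a)⁻¹‖ ≤ c⁻¹ := by
        rw [norm_inv, Y.toW21_eq ha, Complex.norm_real, Real.norm_of_nonneg (Y.val_pos a).le]
        exact inv_anti₀ hc (h a)
      have eb : ‖(Y.toW21 b)⁻¹‖ ≤ c⁻¹ := by
        rw [norm_inv, Y.toW21_eq hb, Complex.norm_real, Real.norm_of_nonneg (Y.val_pos b).le]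
        exact inv_anti₀ hc (h b)
      have e : (Y.toW21 a)⁻¹ - (Y.toW21 b)⁻¹
          = ((Y.toW21 a)⁻¹ * (Y.toW21 b)⁻¹) * (Y.toW21 b - Y.toW21 a) := by
        field_simp
      rw [dist_eq_norm, e, norm_mul, norm_mul, norm_sub_rev, dist_eq_norm]
      gcongr)
      (integrable_of_memLp_two Y.memLp_inv) (by
        filter_upwards [Y.toW21.ae_hasDerivAt, ae_restrict_mem measurableSet_Icc] with t h ht
        have h1 := h.inv (Y.toW21_ne_zero ht)
        have h2 : -((((Y.val t)⁻¹ : ℝ) : ℂ) ^ 2) * Y.toW21.deriv t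
            = -Y.toW21.deriv t / Y.toW21 t ^ 2 := by
          rw [Y.toW21_eq ht, Complex.ofReal_inv, inv_pow]
          ring
        rw [h2]
        exact h1))

theorem inv_apply {t : ℝ} (ht : t ∈ Icc (0 : ℝ) 1) : Y.inv t = (Y.toW21 t)⁻¹ :=
  W21.mk_apply _ _ ht

/-- The change of variable `τ(t) = ∫₀ᵗ dx / Y₁²`, an increasing bijection of `[0,1]`. -/
def tau (t : ℝ) : ℝ := ∫ x in (0 : ℝ)..t, 1 / Y.val x ^ 2

/-- The inverse of `τ : [0,1] → [0,1]`. -/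
def tauInv : ℝ → ℝ := Function.invFunOn Y.tau (Icc 0 1)

theorem continuous_density : Continuous fun x => 1 / Y.val x ^ 2 := by
  have := Y.continuous_val
  exact continuous_const.div (this.pow 2) (fun t => (pow_pos (Y.val_pos t) 2).ne')

theorem density_pos (t : ℝ) : 0 < 1 / Y.val t ^ 2 := by
  have := Y.val_pos t
  positivity

theorem hasDerivAt_tau (t : ℝ) : HasDerivAt Y.tau (1 / Y.val t ^ 2) t :=
  Y.continuous_density.integral_hasStrictDerivAt 0 t |>.hasDerivAt

theorem strictMono_tau : StrictMono Y.tau :=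
  strictMono_of_hasDerivAt_pos Y.hasDerivAt_tau Y.density_pos

@[simp] theorem tau_zero : Y.tau 0 = 0 := by simp [tau]
@[simp] theorem tau_one : Y.tau 1 = 1 := Y.integral_eq_one

theorem continuous_tau : Continuous Y.tau :=
  continuous_iff_continuousAt.2 fun t => (Y.hasDerivAt_tau t).continuousAt

theorem image_tau {t : ℝ} (ht : 0 ≤ t) : Y.tau '' Icc 0 t = Icc 0 (Y.tau t) := by
  rw [Y.continuous_tau.continuousOn.image_Icc_of_monotoneOn ht
    (Y.strictMono_tau.monotone.monotoneOn _), tau_zero]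

theorem tau_mem {t : ℝ} (ht : t ∈ Icc (0 : ℝ) 1) : Y.tau t ∈ Icc (0 : ℝ) 1 := by
  have := mem_image_of_mem Y.tau ht
  rwa [Y.image_tau zero_le_one, tau_one] at this

theorem exists_tau_eq {s : ℝ} (hs : s ∈ Icc (0 : ℝ) 1) : ∃ t ∈ Icc (0 : ℝ) 1, Y.tau t = s := by
  rw [← Y.tau_one, ← Y.image_tau zero_le_one] at hs
  exact hs

theorem tauInv_tau {t : ℝ} (ht : t ∈ Icc (0 : ℝ) 1) : Y.tauInv (Y.tau t) = t :=
  Y.strictMono_tau.injective.injOn.leftInvOn_invFunOn ht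

theorem integral_comp_tau (g : ℝ → ℂ) {t : ℝ} (ht : 0 ≤ t) :
    ∫ u in (0 : ℝ)..Y.tau t, g u
      = ∫ x in (0 : ℝ)..t, ((1 / Y.val x ^ 2 : ℝ) : ℂ) * g (Y.tau x) := by
  have h0 : 0 ≤ Y.tau t := by
    rw [← Y.tau_zero]; exact Y.strictMono_tau.monotone ht
  rw [intervalIntegral.integral_of_le h0, intervalIntegral.integral_of_le ht,
    ← integral_Icc_eq_integral_Ioc, ← integral_Icc_eq_integral_Ioc, ← Y.image_tau ht,
    integral_image_eq_integral_abs_deriv_smul measurableSet_Icc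
      (fun x _ => (Y.hasDerivAt_tau x).hasDerivWithinAt) Y.strictMono_tau.injective.injOn]
  refine integral_congr_ae (Eventually.of_forall fun x => ?_)
  simp only [abs_of_pos (Y.density_pos x), Complex.real_smul]

theorem integrable_comp_tau {F : Type*} [NormedAddCommGroup F] [NormedSpace ℝ F] (g : ℝ → F) :
    Integrable g μI ↔ Integrable (fun x => (1 / Y.val x ^ 2) • g (Y.tau x)) μI := by
  have := integrableOn_image_iff_integrableOn_abs_deriv_smul (measurableSet_Icc (a := (0 : ℝ))
    (b := 1)) (fun x _ => (Y.hasDerivAt_tau x).hasDerivWithinAt)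
    Y.strictMono_tau.injective.injOn g
  rw [Y.image_tau zero_le_one, tau_one] at this
  simpa only [IntegrableOn, abs_of_pos (Y.density_pos _)] using this

theorem memLp_density (y : W21) :
    MemLp (fun x => ((1 / Y.val x ^ 2 : ℝ) : ℂ) * y.deriv (Y.tau x)) 2 μI := by
  have h1 := (Y.integrable_comp_tau _).1 (integrable_L2 y.deriv)
  simp only [Complex.real_smul] at h1
  rw [memLp_two_iff_integrable_sq_norm h1.1]
  have h2 := (Y.integrable_comp_tau _).1
    ((memLp_two_iff_integrable_sq_norm (Lp.aestronglyMeasurable y.deriv)).1 (Lp.memLp y.deriv))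
  obtain ⟨C, hC⟩ := isCompact_Icc.exists_bound_of_continuousOn
    (Y.continuous_density.continuousOn (s := Icc (0 : ℝ) 1))
  have h3 := h2.bdd_mul (c := C) Y.continuous_density.aestronglyMeasurable (by
    filter_upwards [ae_restrict_mem measurableSet_Icc] with t ht using hC t ht)
  refine h3.congr (Eventually.of_forall fun x => ?_)
  simp only [norm_mul, Complex.norm_real, smul_eq_mul,
    Real.norm_of_nonneg (Y.density_pos x).le]
  ring

theorem memLp_tauInv (y : W21) :
    MemLp (fun s => ((Y.val (Y.tauInv s) ^ 2 : ℝ) : ℂ) * y.deriv (Y.tauInv s)) 2 μI := by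
  have hne : ∀ x, Y.val x ≠ 0 := fun x => (Y.val_pos x).ne'
  have h1 : Integrable
      (fun s => ((Y.val (Y.tauInv s) ^ 2 : ℝ) : ℂ) * y.deriv (Y.tauInv s)) μI := by
    rw [Y.integrable_comp_tau]
    refine (integrable_L2 y.deriv).congr ?_
    filter_upwards [ae_restrict_mem measurableSet_Icc] with t ht
    rw [Y.tauInv_tau ht, Complex.real_smul, ← mul_assoc, ← Complex.ofReal_mul,
      one_div, inv_mul_cancel₀ (pow_ne_zero 2 (hne t)), Complex.ofReal_one, one_mul]
  rw [memLp_two_iff_integrable_sq_norm h1.1, Y.integrable_comp_tau]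
  have h2 := (memLp_two_iff_integrable_sq_norm (Lp.aestronglyMeasurable y.deriv)).1
    (Lp.memLp y.deriv)
  have hc : Continuous fun t => Y.val t ^ 2 := Y.continuous_val.pow 2
  obtain ⟨C, hC⟩ := isCompact_Icc.exists_bound_of_continuousOn
    (hc.continuousOn (s := Icc (0 : ℝ) 1))
  have h3 := h2.bdd_mul (c := C) hc.aestronglyMeasurable (by
    filter_upwards [ae_restrict_mem measurableSet_Icc] with t ht using hC t ht)
  refine h3.congr ?_
  filter_upwards [ae_restrict_mem measurableSet_Icc] with t ht
  rw [Y.tauInv_tau ht, norm_mul, Complex.norm_real, Real.norm_of_nonneg (by positivity),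
    smul_eq_mul]
  have := hne t
  field_simp

/-- The function `y ∘ τ`. -/
def compTau (y : W21) : W21 :=
  W21.mk (fun t => y (Y.tau t)) (fun x => ((1 / Y.val x ^ 2 : ℝ) : ℂ) * y.deriv (Y.tau x))
    (Y.memLp_density y) (fun t ht => by
      rw [y.apply_eq (Y.tau_mem ht), Y.integral_comp_tau _ ht.1, tau_zero])

/-- The function `Jy = y ∘ τ⁻¹`, that is, `[Jy](τ(t)) = y(t)`. -/
def compTauInv (y : W21) : W21 :=
  W21.mk (fun s => y (Y.tauInv s))
    (fun s => ((Y.val (Y.tauInv s) ^ 2 : ℝ) : ℂ) * y.deriv (Y.tauInv s))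
    (Y.memLp_tauInv y) (fun s hs => by
      obtain ⟨t, ht, rfl⟩ := Y.exists_tau_eq hs
      have e0 : Y.tauInv 0 = 0 := by
        have := Y.tauInv_tau (t := 0) (by simp)
        rwa [tau_zero] at this
      rw [Y.tauInv_tau ht, e0, Y.integral_comp_tau _ ht.1, y.apply_eq ht]
      congr 1
      refine intervalIntegral.integral_congr fun x hx => ?_
      rw [uIcc_of_le ht.1] at hx
      have := (Y.val_pos x).ne'
      simp only [Y.tauInv_tau ⟨hx.1, hx.2.trans ht.2⟩]
      rw [← mul_assoc, ← Complex.ofReal_mul, one_div,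
        inv_mul_cancel₀ (pow_ne_zero 2 this), Complex.ofReal_one, one_mul])

theorem compTau_apply (y : W21) {t : ℝ} (ht : t ∈ Icc (0 : ℝ) 1) :
    Y.compTau y t = y (Y.tau t) := W21.mk_apply _ _ ht

theorem compTauInv_apply (y : W21) {t : ℝ} (ht : t ∈ Icc (0 : ℝ) 1) :
    Y.compTauInv y (Y.tau t) = y t := by
  have := W21.mk_apply (Y.memLp_tauInv y) (f := fun s => y (Y.tauInv s)) (by
      intro s hs
      have := (Y.compTauInv y).apply_eq hs
      rw [compTauInv, W21.mk_apply _ _ hs, W21.mk_apply _ _ (by simp)] at this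
      rw [this, integral_congr_of_ae (W21.deriv_mk _ _) hs]) (Y.tau_mem ht)
  rw [Y.tauInv_tau ht] at this
  exact this

/-- The operator `J` of change of variable, `[Jy](τ(t)) = y(t)`, as an isomorphism of
`W₂¹[0,1]`. -/
def J : W21 ≃L[ℂ] W21 where
  toFun := Y.compTauInv
  invFun := Y.compTau
  left_inv y := W21.ext fun t ht => by rw [compTau_apply Y _ ht, compTauInv_apply Y _ ht]
  right_inv y := W21.ext fun s hs => by
    obtain ⟨t, ht, rfl⟩ := Y.exists_tau_eq hs
    rw [compTauInv_apply Y _ ht, compTau_apply Y _ ht]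
  map_add' y z := W21.ext fun s hs => by
    obtain ⟨t, ht, rfl⟩ := Y.exists_tau_eq hs
    simp only [W21.add_apply, compTauInv_apply Y _ ht]
  map_smul' c y := W21.ext fun s hs => by
    obtain ⟨t, ht, rfl⟩ := Y.exists_tau_eq hs
    simp only [RingHom.id_apply, W21.smul_apply, compTauInv_apply Y _ ht]
  continuous_toFun := W21.continuous_of_eval
    { toFun := Y.compTauInv
      map_add' := fun y z => W21.ext fun s hs => by
        obtain ⟨t, ht, rfl⟩ := Y.exists_tau_eq hs
        simp only [W21.add_apply, compTauInv_apply Y _ ht]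
      map_smul' := fun c y => W21.ext fun s hs => by
        obtain ⟨t, ht, rfl⟩ := Y.exists_tau_eq hs
        simp only [RingHom.id_apply, W21.smul_apply, compTauInv_apply Y _ ht] }
    (fun s hs => by
      obtain ⟨t, ht, rfl⟩ := Y.exists_tau_eq hs
      have : (fun y : W21 => Y.compTauInv y (Y.tau t)) = fun y => W21.evalL t y :=
        funext fun y => compTauInv_apply Y y ht
      show Continuous (fun y : W21 => Y.compTauInv y (Y.tau t))
      rw [this]
      exact (W21.evalL t).continuous)
  continuous_invFun := W21.continuous_of_eval
    { toFun := Y.compTau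
      map_add' := fun y z => W21.ext fun s hs => by
        simp only [W21.add_apply, compTau_apply Y _ hs]
      map_smul' := fun c y => W21.ext fun s hs => by
        simp only [RingHom.id_apply, W21.smul_apply, compTau_apply Y _ hs] }
    (fun s hs => by
      have : (fun y : W21 => Y.compTau y s) = fun y => W21.evalL (Y.tau s) y :=
        funext fun y => compTau_apply Y y hs
      show Continuous (fun y : W21 => Y.compTau y s)
      rw [this]
      exact (W21.evalL (Y.tau s)).continuous)

theorem J_apply_tau (y : W21) {t : ℝ} (ht : t ∈ Icc (0 : ℝ) 1) : Y.J y (Y.tau t) = y t :=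
  Y.compTauInv_apply y ht

/-- The operator `J_∞` in `L_∞[0,1]`, on representatives: `[J_∞ p](τ(t)) = p(t)`. -/
def JInfty (p : ℝ → ℝ) : ℝ → ℝ := fun s => p (Y.tauInv s)

/-- The continuous extension `J₋₁ : W₂⁻¹[0,1] → W₂⁻¹[0,1]` of `J`. Since `ds = Y₁⁻²(t) dt` for
`s = τ(t)`, it is given by `⟨J₋₁ f, z⟩ = ⟨f, Y₁⁻² · (z ∘ τ)⟩`. -/
def JNeg : WNeg →L[ℂ] WNeg :=
  ContinuousLinearMap.precomp ℂ
    ((W21.mulL (W21.mul Y.inv Y.inv)).comp (Y.J.symm : W21 →L[ℂ] W21))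

theorem JNeg_apply (f : WNeg) (z : W21) :
    Y.JNeg f z = f (W21.mul (W21.mul Y.inv Y.inv) (Y.J.symm z)) := rfl

/-- `J₋₁` does extend `J` (functions being identified with the functionals they define). -/
theorem JNeg_ofL2 (y : W21) :
    Y.JNeg (WNeg.ofL2 (W21.toL2 y)) = WNeg.ofL2 (W21.toL2 (Y.J y)) := by
  have key : ∀ a b : W21,
      WNeg.ofL2 (W21.toL2 a) b = ∫ x in (0 : ℝ)..1, a x * b x := by
    intro a b
    have ha : (W21.toL2 a : ℝ → ℂ) =ᵐ[μI] fun t => a t := (a.memLp_coe 2).coeFn_toLp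
    have hb : (W21.toL2 b : ℝ → ℂ) =ᵐ[μI] fun t => b t := (b.memLp_coe 2).coeFn_toLp
    show inner ℂ (star (W21.toL2 a) : L2I) (W21.toL2 b) = _
    rw [L2.inner_def, intervalIntegral.integral_of_le zero_le_one,
      ← integral_Icc_eq_integral_Ioc]
    refine integral_congr_ae ?_
    filter_upwards [ha, hb, Lp.coeFn_star (W21.toL2 a)] with t h1 h2 h3
    rw [h3, h2, Pi.star_apply, h1]
    simp [mul_comm]
  ext z
  rw [JNeg_apply, key, key]
  have := Y.integral_comp_tau (fun u => Y.J y u * z u) (t := 1) zero_le_one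
  rw [tau_one] at this
  rw [this]
  refine intervalIntegral.integral_congr fun x hx => ?_
  rw [uIcc_of_le zero_le_one] at hx
  have e : Y.J.symm z x = z (Y.tau x) := Y.compTau_apply z hx
  simp only [Y.J_apply_tau y hx, W21.mul_apply _ _ hx, e, Y.inv_apply hx, Y.toW21_eq hx]
  have : ((Y.val x : ℝ) : ℂ) ≠ 0 := by exact_mod_cast (Y.val_pos x).ne'
  push_cast
  field_simp

end PositiveFactor

/-! ### The spaces `𝔥_U`, `𝔥'_U` and the pencil -/

/-- The vector `y^∧ = (y(0), y(1))` of boundary values. -/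
def trace : W21 →L[ℂ] (Fin 2 → ℂ) :=
  ContinuousLinearMap.pi ![W21.evalL 0, W21.evalL 1]

/-- The Hilbert space `𝔥_U = {y ∈ W₂¹[0,1] | y^∧ ∈ im (U - 1)}`. -/
def HU (U : Matrix (Fin 2) (Fin 2) ℂ) : Submodule ℂ W21 :=
  (LinearMap.range (U - 1).mulVecLin).comap (trace : W21 →ₗ[ℂ] (Fin 2 → ℂ))

theorem mem_HU {U : Matrix (Fin 2) (Fin 2) ℂ} {y : W21} :
    y ∈ HU U ↔ ∃ v : Fin 2 → ℂ, (U - 1).mulVec v = ![y 0, y 1] := by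
  have : trace y = ![y 0, y 1] := by
    funext i; fin_cases i <;> rfl
  rw [← this]
  exact Iff.rfl

instance (U : Matrix (Fin 2) (Fin 2) ℂ) : CompleteSpace (HU U) :=
  IsClosed.completeSpace_coe (hs :=
    (Submodule.closed_of_finiteDimensional (LinearMap.range (U - 1).mulVecLin)).preimage
      trace.continuous)

section
variable (U : Matrix (Fin 2) (Fin 2) ℂ)

/-- The embedding operator `I : 𝔥_U → L₂[0,1]`. -/
def embed : HU U →L[ℂ] L2I := W21.toL2L.comp (HU U).subtypeL

/-- The space `L₂[0,1]` with the norm `‖f‖ = ‖I* f‖`, where `I* : L₂[0,1] → 𝔥_U`. -/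
def PreHUNeg (_U : Matrix (Fin 2) (Fin 2) ℂ) : Type := L2I

instance : AddCommGroup (PreHUNeg U) := inferInstanceAs (AddCommGroup L2I)
instance : Module ℂ (PreHUNeg U) := inferInstanceAs (Module ℂ L2I)

/-- The operator `I* : L₂[0,1] → 𝔥_U`. -/
def embedStar : PreHUNeg U →ₗ[ℂ] HU U :=
  ((ContinuousLinearMap.adjoint (embed U) : L2I →L[ℂ] HU U) : L2I →ₗ[ℂ] HU U)

instance : SeminormedAddCommGroup (PreHUNeg U) :=
  SeminormedAddCommGroup.induced (PreHUNeg U) (HU U) (embedStar U)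
instance : NormedSpace ℂ (PreHUNeg U) :=
  NormedSpace.induced ℂ (PreHUNeg U) (HU U) (embedStar U)

/-- The space `𝔥'_U`: the completion of `L₂[0,1]` with respect to the norm `‖I* f‖`. -/
abbrev HUNeg : Type := UniformSpace.Completion (PreHUNeg U)

/-- The isometry `I⁺ : 𝔥'_U → 𝔥_U` extending `I*` by continuity. -/
def embedPlus : HUNeg U →L[ℂ] HU U :=
  ContinuousLinearMap.extend
    (⟨embedStar U, AddMonoidHomClass.continuous_of_bound (embedStar U) 1
      (fun f => by rw [one_mul]; exact le_refl _)⟩ : PreHUNeg U →L[ℂ] HU U)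
    (UniformSpace.Completion.toComplL : PreHUNeg U →L[ℂ] HUNeg U)

theorem embedPlus_coe (f : PreHUNeg U) : embedPlus U (f : HUNeg U) = embedStar U f :=
  ContinuousLinearMap.extend_eq _ UniformSpace.Completion.denseRange_coe
    (UniformSpace.Completion.isUniformInducing_coe _) f

/-- The diagonal hermitian matrix `V` with entries `V_kk = -ctg (arg U_kk / 2)` if `U_kk ≠ 1`
and `V_kk = 0` if `U_kk = 1`. -/
def boundaryMatrix : Matrix (Fin 2) (Fin 2) ℂ :=
  open Classical in
  Matrix.diagonal fun k =>
    if U k k = 1 then 0 else ((-Real.cot ((U k k).arg / 2) : ℝ) : ℂ)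

/-- `T` is the operator pencil `𝔥_U → 𝔥'_U` of the problem
`-(p y')' + (q - λ r) y = 0`, `(U - 1) y^∨ + i (U + 1) y^∧ = 0`, that is,
`⟨I⁺ T(λ) y, y⟩ = ∫₀¹ p |y'|² dx + ∫₀¹ (q - λ r) |y|² dx + ⟨V y^∧, y^∧⟩`. -/
def IsPencil (p : ℝ → ℝ) (q r : WNeg) (T : ℂ → HU U →L[ℂ] HUNeg U) : Prop :=
  ∀ (lam : ℂ) (y : HU U),
    inner ℂ y (embedPlus U (T lam y)) =
      ((∫ t in (0 : ℝ)..1, p t * ‖(y : W21).deriv t‖ ^ 2 : ℝ) : ℂ)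
      + (q - lam • r) (W21.mul y (W21.conjugate y))
      + star (trace y) ⬝ᵥ (boundaryMatrix U).mulVec (trace y)

/-- The boundary conditions `(U - 1) y^∨ + i (U + 1) y^∧ = 0`, where `y^∧ = (y(0), y(1))` and
`y^∨ = (y^[1](0), -y^[1](1))`, have the form `C (y(0)) (y(1)) (y^[1](0)) (y^[1](1))`. -/
def HasBoundaryConditions (C : ℂ → ℂ → ℂ → ℂ → Prop) : Prop :=
  ∀ y₀ y₁ d₀ d₁ : ℂ,
    (U - 1).mulVec ![d₀, -d₁] + Complex.I • (U + 1).mulVec ![y₀, y₁] = 0 ↔ C y₀ y₁ d₀ d₁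

end

/-- `p` represents a uniformly positive element of `L_∞[0,1]`. -/
def UniformlyPositive (p : ℝ → ℝ) : Prop :=
  MemLp p ∞ μI ∧ ∃ c : ℝ, 0 < c ∧ ∀ᵐ t ∂μI, c ≤ p t

/-- `ω ∈ L₂[0,1]` and `ω₁ ∈ ℝ` satisfy `∫₀¹ f ȳ dx = -∫₀¹ ω ȳ' dx + ω₁ ȳ(1)` for all
`y ∈ W₂¹[0,1]`. -/
def IsAntiderivative (f : WNeg) (ω : ℝ → ℝ) (ω₁ : ℝ) : Prop :=
  MemLp ω 2 μI ∧ ∀ y : W21,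
    f (W21.conjugate y) =
      -(∫ t in (0 : ℝ)..1, (ω t : ℂ) * starRingEnd ℂ (y.deriv t))
        + (ω₁ : ℂ) * starRingEnd ℂ (y 1)

/-- `(Y₁, Y₂) ∈ W₂¹[0,1] × W₁¹[0,1]` satisfies
`Y₁' = (ω / p) Y₁ + (1 / p) Y₂`, `Y₂' = -(ω² / p) Y₁ - (ω / p) Y₂` almost everywhere. -/
def IsSystemSolution (p ω : ℝ → ℝ) (Y₁ : PositiveFactor) (Y₂ : ℝ → ℝ) : Prop :=
  (∀ᵐ t ∂μI, Y₁.toW21.deriv t = ((ω t / p t * Y₁.val t + 1 / p t * Y₂ t : ℝ) : ℂ)) ∧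
  IntervalIntegrable (fun t => -(ω t ^ 2 / p t) * Y₁.val t - ω t / p t * Y₂ t) volume 0 1 ∧
  ∀ t ∈ Icc (0 : ℝ) 1,
    Y₂ t = Y₂ 0 + ∫ x in (0 : ℝ)..t, (-(ω x ^ 2 / p x) * Y₁.val x - ω x / p x * Y₂ x)

end SturmLiouville

end

open SturmLiouville

/-! Over `ℂ` a bounded operator is determined by its quadratic form, so the operator identity
reduces to an equality of forms: that of the transformed problem at `Sy` equals that of the original
one at `y`. This rests on Jacobi's factorization. Put `u = y / Y₁`, `N = |y|²`. The system says
`pY₁' = ωY₁ + Y₂` and `Y₂' = -ωY₁'`, whence pointwise `pY₁²|u'|² = p|y'|² - ωN' - (Y₂N/Y₁)'`.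
Integration turns `-∫ωN'` into the pairing of `q - ξr` with `N`, up to `ω₁N(1)`, and leaves the
boundary terms `(Y₂(1)/Y₁(1) + ω₁)|y(1)|² - (Y₂(0)/Y₁(0))|y(0)|²` (`quadForm_identity`). Under `s =
τ(t)` one has `ds = Y₁⁻²dt` and `(Ju)' = Y₁²u'`, so `∫pY₁²|u'|²dt` is the leading term of the new
form; the weight `Y₁⁴r` compensates the Jacobian and the two factors `1/Y₁`, so the term with `(ξ -
λ)r` is preserved (`JNeg_substitution`).

The boundary terms vanish in case (a) by the Dirichlet conditions and in case (b) by `Y₂(0) = 0` and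
`y(1) = 0`. In case (c) the term at `1` survives and is exactly the Robin term of the new problem
(`boundary_correspondence`).

The pencils are well defined because the forms are bounded and `I⁺` is onto: every bounded operator
of `𝔥_U` is `I⁺T` for exactly one `T` (`existsUnique_isPencil`). -/

noncomputable section
namespace SturmLiouville

/-! ### Operators given by forms on a Hilbert space -/

/-- A separately continuous sesquilinear form on a Hilbert space is given by a bounded operator
(Riesz representation and the closed graph theorem). -/
theorem exists_operator_of_sesquilinear {H : Type*} [NormedAddCommGroup H]
    [InnerProductSpace ℂ H] [CompleteSpace H] (L R : H → StrongDual ℂ H)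
    (h : ∀ y z, R y z = conj (L z y)) : ∃ A : H →L[ℂ] H, ∀ y z, inner ℂ z (A y) = L z y := by
  let A₀ : H → H := fun y => (InnerProductSpace.toDual ℂ H).symm (R y)
  have hA : ∀ y z, inner ℂ z (A₀ y) = L z y := by
    intro y z
    rw [← inner_conj_symm, InnerProductSpace.toDual_symm_apply, h, Complex.conj_conj]
  let A₁ : H →ₗ[ℂ] H :=
    { toFun := A₀
      map_add' := fun x y => ext_inner_left ℂ fun z => by
        rw [inner_add_right, hA, hA, hA, map_add]
      map_smul' := fun c y => ext_inner_left ℂ fun z => by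
        rw [RingHom.id_apply, inner_smul_right, hA, hA, map_smul, smul_eq_mul] }
  -- No joint bound on the form is assumed. Continuity of each `L z` identifies the weak limit of
  -- `A₁ (u n)`, and this closes the graph.
  refine ⟨⟨A₁, A₁.continuous_of_seq_closed_graph fun u x y hu hAu => ?_⟩, hA⟩
  refine ext_inner_left ℂ fun z => ?_
  have h1 : Tendsto (fun n => inner ℂ z (A₁ (u n))) atTop (𝓝 (inner ℂ z y)) :=
    (tendsto_const_nhds).inner hAu
  have h2 : Tendsto (fun n => inner ℂ z (A₁ (u n))) atTop (𝓝 (L z x)) := by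
    have : (fun n => inner ℂ z (A₁ (u n))) = fun n => L z (u n) := funext fun n => hA _ _
    rw [this]
    exact ((L z).continuous.tendsto x).comp hu
  rw [tendsto_nhds_unique h1 h2]
  exact (hA x z).symm

/-- The operators of a complex Hilbert space are determined by their quadratic forms. -/
theorem operator_ext_quadratic {H : Type*} [NormedAddCommGroup H]
    [InnerProductSpace ℂ H] {A B : H →L[ℂ] H}
    (h : ∀ y, inner ℂ y (A y) = inner ℂ y (B y)) : A = B := by
  have : (A : H →ₗ[ℂ] H) = B := by
    rw [← ext_inner_map]
    intro y
    rw [← inner_conj_symm, ← inner_conj_symm (B.toLinearMap y)]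
    exact congrArg _ (h y)
  exact ContinuousLinearMap.coe_injective this

/-! ### Conjugation and products in `W₂¹[0,1]` -/

namespace W21

theorem deriv_conjugate (y : W21) :
    (conjugate y).deriv =ᵐ[μI] fun t => conj (y.deriv t) := deriv_mk _ _

theorem deriv_mul (a y : W21) :
    (mul a y).deriv =ᵐ[μI] fun t => y t * a.deriv t + a t * y.deriv t := deriv_mk _ _

theorem coeFn_toL2 (y : W21) : (toL2 y : ℝ → ℂ) =ᵐ[μI] fun t => y t :=
  (y.memLp_coe 2).coeFn_toLp

theorem norm_conjugate (y : W21) : ‖conjugate y‖ = ‖y‖ := by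
  have h1 : ‖(conjugate y).deriv‖ = ‖y.deriv‖ := by
    rw [Lp.norm_def, Lp.norm_def]
    congr 1
    refine eLpNorm_congr_norm_ae ?_
    filter_upwards [deriv_conjugate y] with t ht
    rw [ht, RCLike.norm_conj]
  have h2 : ‖toL2 (conjugate y)‖ = ‖toL2 y‖ := by
    rw [Lp.norm_def, Lp.norm_def]
    congr 1
    refine eLpNorm_congr_norm_ae ?_
    filter_upwards [coeFn_toL2 y, coeFn_toL2 (conjugate y), ae_restrict_mem measurableSet_Icc]
      with t h1 h2 ht
    rw [h1, h2, conjugate_apply _ ht, RCLike.norm_conj]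
  have h3 := norm_sq_eq y
  rw [← h1, ← h2, ← norm_sq_eq] at h3
  exact ((sq_eq_sq₀ (norm_nonneg _) (norm_nonneg _)).1 h3).symm

/-- Complex conjugation as a bounded conjugate-linear operator. -/
def conjL : W21 →L⋆[ℂ] W21 :=
  LinearMap.mkContinuous
    { toFun := conjugate
      map_add' := fun y z => ext fun t ht => by
        simp only [add_apply, conjugate_apply _ ht, map_add]
      map_smul' := fun c y => ext fun t ht => by
        simp only [smul_apply, conjugate_apply _ ht, map_mul] } 1
    (fun y => by rw [one_mul]; exact (norm_conjugate y).le)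

@[simp] theorem conjL_apply (y : W21) : conjL y = conjugate y := rfl

theorem mul_comm (a y : W21) : mul a y = mul y a :=
  ext fun t ht => by rw [mul_apply _ _ ht, mul_apply _ _ ht, _root_.mul_comm]

theorem conjugate_mul (a y : W21) : conjugate (mul a y) = mul (conjugate a) (conjugate y) :=
  ext fun t ht => by
    rw [conjugate_apply _ ht, mul_apply _ _ ht, mul_apply _ _ ht, conjugate_apply _ ht,
      conjugate_apply _ ht, map_mul]

theorem conjugate_conjugate (y : W21) : conjugate (conjugate y) = y :=
  ext fun t ht => by rw [conjugate_apply _ ht, conjugate_apply _ ht, Complex.conj_conj]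

theorem mulL_apply (a y : W21) : mulL a y = mul a y := rfl

theorem integral_eq_setIntegral {E : Type*} [NormedAddCommGroup E] [NormedSpace ℝ E]
    (g : ℝ → E) : ∫ t in (0 : ℝ)..1, g t = ∫ t, g t ∂μI := by
  rw [intervalIntegral.integral_of_le zero_le_one, integral_Icc_eq_integral_Ioc]

theorem memLp_coeff_mul_deriv {p : ℝ → ℝ} (hp : MemLp p ∞ μI) (y : W21) :
    MemLp (fun t => (p t : ℂ) * y.deriv t) 2 μI :=
  (Lp.memLp y.deriv).mul' (p := ∞) hp.ofReal

end W21

/-! ### Boundedness of the forms, surjectivity of `I⁺`, existence of pencils -/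

section
variable (U : Matrix (Fin 2) (Fin 2) ℂ)

/-- The quadratic form of the problem with coefficients `p` and `f` and boundary matrix `U`. -/
def quadForm (p : ℝ → ℝ) (f : WNeg) (y : W21) : ℂ :=
  ((∫ t in (0 : ℝ)..1, p t * ‖y.deriv t‖ ^ 2 : ℝ) : ℂ) + f (W21.mul y (W21.conjugate y))
    + star (trace y) ⬝ᵥ (boundaryMatrix U).mulVec (trace y)

theorem exists_operator_deriv {p : ℝ → ℝ} (hp : MemLp p ∞ μI) : ∃ A : W21 →L[ℂ] W21, ∀ y,
    inner ℂ y (A y) = ((∫ t in (0 : ℝ)..1, p t * ‖y.deriv t‖ ^ 2 : ℝ) : ℂ) := by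
  let L : W21 → StrongDual ℂ W21 := fun z =>
    (innerSL ℂ ((W21.memLp_coeff_mul_deriv hp z).toLp _)).comp W21.derivL
  have hL : ∀ z y, L z y = ∫ t, (p t : ℂ) * conj (z.deriv t) * y.deriv t ∂μI := by
    intro z y
    show inner ℂ ((W21.memLp_coeff_mul_deriv hp z).toLp _) y.deriv = _
    rw [L2.inner_def]
    refine integral_congr_ae ?_
    filter_upwards [(W21.memLp_coeff_mul_deriv hp z).coeFn_toLp] with t ht
    rw [ht]
    simp only [RCLike.inner_apply, map_mul, Complex.conj_ofReal]
    ring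
  -- The form `∫ p z̄' y'` is hermitian because `p` is real, so one family of functionals serves for
  -- both arguments.
  obtain ⟨A, hA⟩ := exists_operator_of_sesquilinear L L (fun y z => by
    rw [hL, hL, ← integral_conj]
    refine integral_congr_ae (Eventually.of_forall fun t => ?_)
    simp only [map_mul, Complex.conj_ofReal, Complex.conj_conj]
    ring)
  refine ⟨A, fun y => ?_⟩
  rw [hA, hL, W21.integral_eq_setIntegral, ← integral_complex_ofReal]
  refine integral_congr_ae (Eventually.of_forall fun t => ?_)
  simp only [mul_assoc]
  rw [Complex.conj_mul']
  push_cast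
  rfl

theorem exists_operator_potential (f : WNeg) : ∃ A : W21 →L[ℂ] W21, ∀ y,
    inner ℂ y (A y) = f (W21.mul y (W21.conjugate y)) := by
  -- A generalized function `f` need not be real: the functionals in the other argument come from
  -- its complex conjugate.
  let fc : WNeg :=
    ((ContinuousLinearMap.comp (starL ℂ : ℂ ≃L⋆[ℂ] ℂ).toContinuousLinearMap f).comp W21.conjL)
  have hfc : ∀ y, fc y = conj (f (W21.conjugate y)) := fun y => rfl
  obtain ⟨A, hA⟩ := exists_operator_of_sesquilinear
    (fun z => f.comp (W21.mulL (W21.conjugate z))) (fun y => fc.comp (W21.mulL (W21.conjugate y)))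
    (fun y z => by
      rw [ContinuousLinearMap.comp_apply fc, ContinuousLinearMap.comp_apply f, hfc,
        W21.mulL_apply, W21.mulL_apply, W21.conjugate_mul, W21.conjugate_conjugate, W21.mul_comm])
  refine ⟨A, fun y => ?_⟩
  rw [hA, ContinuousLinearMap.comp_apply, W21.mulL_apply, W21.mul_comm]

/-- Point values are bounded functionals on `W₂¹[0,1]`, so their Riesz vectors yield a finite-rank
operator with this form. -/
theorem exists_operator_boundary (V : Matrix (Fin 2) (Fin 2) ℂ) : ∃ A : W21 →L[ℂ] W21, ∀ y,
    inner ℂ y (A y) = star (trace y) ⬝ᵥ V.mulVec (trace y) := by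
  let e : Fin 2 → W21 := fun i =>
    (InnerProductSpace.toDual ℂ W21).symm ((ContinuousLinearMap.proj i).comp trace)
  have he : ∀ i y, inner ℂ (e i) y = trace y i := fun i y =>
    InnerProductSpace.toDual_symm_apply
  refine ⟨∑ i, ∑ j, (V i j • ((ContinuousLinearMap.proj j).comp trace)).smulRight (e i),
    fun y => ?_⟩
  have he' : ∀ i, inner ℂ y (e i) = conj (trace y i) := fun i => by
    rw [← inner_conj_symm, he]
  simp only [sum_apply, inner_sum, ContinuousLinearMap.smulRight_apply,
    inner_smul_right, he', dotProduct, Matrix.mulVec, Finset.mul_sum]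
  refine Finset.sum_congr rfl fun i _ => Finset.sum_congr rfl fun j _ => ?_
  simp only [smul_apply, ContinuousLinearMap.comp_apply,
    ContinuousLinearMap.proj_apply, smul_eq_mul, Pi.star_apply, RCLike.star_def]
  ring

theorem exists_operator_quadForm {p : ℝ → ℝ} (hp : MemLp p ∞ μI) (f : WNeg) :
    ∃ A : HU U →L[ℂ] HU U, ∀ y : HU U, inner ℂ y (A y) = quadForm U p f y := by
  obtain ⟨A, hA⟩ := exists_operator_deriv hp
  obtain ⟨B, hB⟩ := exists_operator_potential f
  obtain ⟨C, hC⟩ := exists_operator_boundary (boundaryMatrix U)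
  -- Compression to the closed subspace `HU U`; it does not change the form there.
  refine ⟨(ContinuousLinearMap.adjoint (HU U).subtypeL) ∘L (A + B + C) ∘L (HU U).subtypeL,
    fun y => ?_⟩
  rw [ContinuousLinearMap.comp_apply, ContinuousLinearMap.adjoint_inner_right,
    ContinuousLinearMap.comp_apply]
  simp only [Submodule.subtypeL_apply, add_apply, inner_add_right, hA, hB, hC,
    quadForm]

theorem norm_embedPlus (g : HUNeg U) : ‖embedPlus U g‖ = ‖g‖ := by
  induction g using UniformSpace.Completion.induction_on with
  | hp => exact isClosed_eq (embedPlus U).continuous.norm continuous_norm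
  | ih f => rw [embedPlus_coe, UniformSpace.Completion.norm_coe]; rfl

theorem W21.eq_zero_of_toL2_eq_zero {y : W21} (h : W21.toL2 y = 0) : y = 0 := by
  refine W21.ext ?_
  have h1 : (fun t => y t) =ᵐ[μI] fun _ => 0 := by
    have := W21.coeFn_toL2 y
    rw [h] at this
    filter_upwards [this, Lp.coeFn_zero ℂ 2 μI] with t h1 h2
    rw [← h1, h2, Pi.zero_apply]
  exact Measure.eqOn_Icc_of_ae_eq volume zero_ne_one h1 y.continuous_coe.continuousOn
    continuousOn_const

/-- The range of an isometry of a complete space is closed. It contains the range of `I*`, whose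
orthogonal complement is the kernel of the embedding `I`, which is zero since a continuous function
vanishing almost everywhere vanishes. -/
theorem embedPlus_surjective : Function.Surjective (embedPlus U) := by
  have hiso : Isometry (embedPlus U) :=
    AddMonoidHomClass.isometry_of_norm (embedPlus U) (norm_embedPlus U)
  have hcl : IsClosed (LinearMap.range (embedPlus U).toLinearMap : Set (HU U)) := by
    rw [LinearMap.coe_range]
    exact hiso.isClosedEmbedding.isClosed_range
  have : CompleteSpace (LinearMap.range (embedPlus U).toLinearMap) := hcl.completeSpace_coe
  have htop : LinearMap.range (embedPlus U).toLinearMap = ⊤ := by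
    rw [← Submodule.orthogonal_eq_bot_iff, Submodule.eq_bot_iff]
    intro y hy
    rw [Submodule.mem_orthogonal] at hy
    have h0 : embed U y = 0 := by
      refine ext_inner_left ℂ fun g => ?_
      rw [inner_zero_right, ← ContinuousLinearMap.adjoint_inner_left]
      exact hy _ ⟨((show PreHUNeg U from g) : HUNeg U), embedPlus_coe U g⟩
    exact Subtype.ext (W21.eq_zero_of_toL2_eq_zero h0)
  exact LinearMap.range_eq_top.1 htop

/-- The isometry `I⁺` as an isomorphism. -/
def embedPlusEquiv : HUNeg U ≃ₗᵢ[ℂ] HU U :=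
  LinearIsometryEquiv.ofSurjective ⟨(embedPlus U).toLinearMap, norm_embedPlus U⟩
    (embedPlus_surjective U)

theorem embedPlusEquiv_apply (g : HUNeg U) : embedPlusEquiv U g = embedPlus U g := rfl

theorem isPencil_iff (p : ℝ → ℝ) (q r : WNeg) (T : ℂ → HU U →L[ℂ] HUNeg U) :
    IsPencil U p q r T ↔
      ∀ lam (y : HU U), inner ℂ y (embedPlus U (T lam y)) = quadForm U p (q - lam • r) y :=
  Iff.rfl

/-- A pencil is well defined as soon as its quadratic forms are represented by bounded operators. -/
theorem existsUnique_isPencil {p : ℝ → ℝ} {q r : WNeg} (h : ∀ lam : ℂ, ∃ A : HU U →L[ℂ] HU U,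
    ∀ y : HU U, inner ℂ y (A y) = quadForm U p (q - lam • r) y) :
    ∃! T : ℂ → HU U →L[ℂ] HUNeg U, IsPencil U p q r T := by
  choose A hA using h
  refine ⟨fun lam => ((embedPlusEquiv U).symm : HU U →L[ℂ] HUNeg U) ∘L A lam, ?_, ?_⟩
  · refine (isPencil_iff U p q r _).2 fun lam y => ?_
    rw [← hA, ← embedPlusEquiv_apply]
    exact congrArg _ ((embedPlusEquiv U).apply_symm_apply _)
  · intro T hT
    funext lam
    ext1 y
    refine (embedPlusEquiv U).injective ?_
    -- Uniqueness: the form determines `I⁺T(λ)`, and `I⁺` is injective.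
    have : embedPlus U ∘L T lam = A lam := operator_ext_quadratic fun y => by
      rw [hA]; exact (isPencil_iff U p q r T).1 hT lam y
    refine (DFunLike.congr_fun this y).trans ?_
    exact ((embedPlusEquiv U).apply_symm_apply _).symm

end

/-! ### Integration by parts with one factor in `W₁¹` -/

namespace W21

/-- Integration by parts for an absolutely continuous function and a function from `W₂¹[0,1]`. -/
theorem integral_by_parts {g : ℝ → ℂ} (hg : Integrable g μI) (c : ℂ) (w : W21) :
    Integrable (fun t => g t * w t + (c + ∫ x in (0 : ℝ)..t, g x) * w.deriv t) μI ∧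
    ∫ t, (g t * w t + (c + ∫ x in (0 : ℝ)..t, g x) * w.deriv t) ∂μI
      = (c + ∫ x in (0 : ℝ)..1, g x) * w 1 - c * w 0 := by
  -- Since `g` is merely integrable, its primitive need not lie in `W₂¹[0,1]` and `W21.mul` does not
  -- apply; absolute continuity of the product is enough.
  have hac : AbsolutelyContinuousOnInterval (fun t => c + ∫ x in (0 : ℝ)..t, g x) 0 1 :=
    absCont_of_dist_le zero_le_one (absCont_primitive hg)
      (fun a _ b _ => by rw [dist_add_left, one_mul])
  have h0 : (0 : ℝ) ∈ Icc (0 : ℝ) 1 := by simp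
  have h1 : (1 : ℝ) ∈ Icc (0 : ℝ) 1 := by simp
  have hi := intervalIntegrable_of_integrable hg h0 h1
  have hcont : ContinuousOn (fun t => c + ∫ x in (0 : ℝ)..t, g x) (Icc 0 1) := by
    have := hac.continuousOn
    rwa [uIcc_of_le zero_le_one] at this
  obtain ⟨C, hC⟩ := isCompact_Icc.exists_bound_of_continuousOn hcont
  obtain ⟨D, hD⟩ := isCompact_Icc.exists_bound_of_continuousOn
    (w.continuous_coe.continuousOn (s := Icc (0 : ℝ) 1))
  have hint : Integrable (fun t => g t * w t + (c + ∫ x in (0 : ℝ)..t, g x) * w.deriv t) μI := by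
    refine (hg.mul_bdd (c := D) w.continuous_coe.aestronglyMeasurable ?_).add
      ((integrable_L2 w.deriv).bdd_mul (c := C)
        (hcont.aestronglyMeasurable measurableSet_Icc) ?_)
    · filter_upwards [ae_restrict_mem measurableSet_Icc] with t ht using hD t ht
    · filter_upwards [ae_restrict_mem measurableSet_Icc] with t ht using hC t ht
  refine ⟨hint, ?_⟩
  have hderiv : ∀ᵐ t ∂μI, HasDerivAt (fun t => c + ∫ x in (0 : ℝ)..t, g x) (g t) t := by
    rw [ae_restrict_iff' measurableSet_Icc]
    filter_upwards [hi.ae_hasDerivAt_integral] with t ht htI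
    rw [uIcc_of_le zero_le_one] at ht
    exact (ht htI 0 h0).const_add c
  have key := eq_add_integral (hac.smul w.absCont) hint (by
    filter_upwards [hderiv, w.ae_hasDerivAt] with t ha hb
    exact ha.mul hb) 1 h1
  rw [← integral_eq_setIntegral]
  simp only [Pi.smul_apply', smul_eq_mul, intervalIntegral.integral_same, add_zero] at key
  rw [key]; ring

end W21

/-! ### The substitution `y ↦ J (y / Y₁)` -/

namespace PositiveFactor

variable (Y : PositiveFactor)

theorem deriv_inv : Y.inv.deriv =ᵐ[μI]
    fun t => -((((Y.val t)⁻¹ : ℝ) : ℂ) ^ 2) * Y.toW21.deriv t := W21.deriv_mk _ _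

theorem deriv_J (y : W21) : (Y.J y).deriv =ᵐ[μI]
    fun s => ((Y.val (Y.tauInv s) ^ 2 : ℝ) : ℂ) * y.deriv (Y.tauInv s) := W21.deriv_mk _ _

/-- The operator `y ↦ J (y / Y₁)` of `W₂¹[0,1]`. -/
def substitution (y : W21) : W21 := Y.J (W21.mul Y.inv y)

theorem substitution_tau (y : W21) {t : ℝ} (ht : t ∈ Icc (0 : ℝ) 1) :
    Y.substitution y (Y.tau t) = (Y.val t : ℂ)⁻¹ * y t := by
  rw [substitution, J_apply_tau Y _ ht, W21.mul_apply _ _ ht, Y.inv_apply ht, Y.toW21_eq ht]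

theorem substitution_zero (y : W21) : Y.substitution y 0 = (Y.val 0 : ℂ)⁻¹ * y 0 := by
  have := Y.substitution_tau y (t := 0) (by simp)
  rwa [tau_zero] at this

theorem substitution_one (y : W21) : Y.substitution y 1 = (Y.val 1 : ℂ)⁻¹ * y 1 := by
  have := Y.substitution_tau y (t := 1) (by simp)
  rwa [tau_one] at this

/-- The substitution `y ↦ J (y / Y₁)` as an isomorphism of `W₂¹[0,1]`. -/
def substitutionEquiv : W21 ≃L[ℂ] W21 where
  toFun := Y.substitution
  invFun z := W21.mul Y.toW21 (Y.J.symm z)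
  left_inv y := W21.ext fun t ht => by
    rw [W21.mul_apply _ _ ht, substitution, ContinuousLinearEquiv.symm_apply_apply,
      W21.mul_apply _ _ ht, Y.inv_apply ht, mul_inv_cancel_left₀ (Y.toW21_ne_zero ht)]
  right_inv z := by
    have : W21.mul Y.inv (W21.mul Y.toW21 (Y.J.symm z)) = Y.J.symm z := W21.ext fun t ht => by
      rw [W21.mul_apply _ _ ht, W21.mul_apply _ _ ht, Y.inv_apply ht,
        inv_mul_cancel_left₀ (Y.toW21_ne_zero ht)]
    rw [substitution, this, ContinuousLinearEquiv.apply_symm_apply]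
  map_add' := ((Y.J : W21 →L[ℂ] W21) ∘L W21.mulL Y.inv).map_add
  map_smul' := ((Y.J : W21 →L[ℂ] W21) ∘L W21.mulL Y.inv).map_smul
  continuous_toFun := ((Y.J : W21 →L[ℂ] W21) ∘L W21.mulL Y.inv).continuous
  continuous_invFun := (W21.mulL Y.toW21 ∘L (Y.J.symm : W21 →L[ℂ] W21)).continuous

/-- The pairing of the transformed weight with `|J (y / Y₁)|²`. -/
theorem JNeg_substitution (r : WNeg) (y : W21) :
    Y.JNeg (WNeg.mul (Y.toW21 ^ 4) r)
        (W21.mul (Y.substitution y) (W21.conjugate (Y.substitution y)))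
      = r (W21.mul y (W21.conjugate y)) := by
  rw [JNeg_apply]
  show r (W21.mul (Y.toW21 ^ 4) _) = _
  -- The powers cancel: `Y₁⁴` against the Jacobian `Y₁⁻²` in `J₋₁` and one `Y₁⁻¹` from each of the
  -- two factors.
  congr 1
  refine W21.ext fun t ht => ?_
  have h1 : ∀ z, Y.J.symm z t = z (Y.tau t) := fun z => Y.compTau_apply z ht
  rw [W21.mul_apply _ _ ht, W21.mul_apply _ _ ht, W21.mul_apply _ _ ht, W21.mul_apply _ _ ht, h1,
    W21.mul_apply _ _ (Y.tau_mem ht), W21.conjugate_apply _ (Y.tau_mem ht),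
    W21.conjugate_apply _ ht, W21.pow_apply _ _ ht, Y.substitution_tau _ ht, Y.inv_apply ht,
    Y.toW21_eq ht, map_mul, map_inv₀, Complex.conj_ofReal]
  have : (Y.val t : ℂ) ≠ 0 := by exact_mod_cast (Y.val_pos t).ne'
  field_simp

/-- The leading term of the transformed quadratic form. -/
theorem integral_deriv_substitution (p : ℝ → ℝ) (y : W21) :
    ((∫ s in (0 : ℝ)..1, Y.JInfty p s * ‖(Y.substitution y).deriv s‖ ^ 2 : ℝ) : ℂ)
      = ∫ t, (p t : ℂ) * (Y.val t : ℂ) ^ 2 * ((W21.mul Y.inv y).deriv t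
          * conj ((W21.mul Y.inv y).deriv t)) ∂μI := by
  set u := W21.mul Y.inv y
  have h1 : ((∫ s in (0 : ℝ)..1, Y.JInfty p s * ‖(Y.substitution y).deriv s‖ ^ 2 : ℝ) : ℂ)
      = ∫ s in (0 : ℝ)..1, (p (Y.tauInv s) : ℂ) * (Y.val (Y.tauInv s) : ℂ) ^ 4
          * (u.deriv (Y.tauInv s) * conj (u.deriv (Y.tauInv s))) := by
    rw [← intervalIntegral.integral_ofReal, W21.integral_eq_setIntegral,
      W21.integral_eq_setIntegral]
    refine integral_congr_ae ?_
    filter_upwards [Y.deriv_J u] with s hs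
    rw [substitution, hs, norm_mul, Complex.norm_real, Complex.mul_conj', JInfty,
      Real.norm_of_nonneg (sq_nonneg _)]
    push_cast
    ring
  -- The derivative of `Ju` contributes `Y₁⁴`, the Jacobian `Y₁⁻²`. The change of variable holds for
  -- an arbitrary integrand, so measurability of `p ∘ τ⁻¹` is not needed.
  have h2 := Y.integral_comp_tau (fun s => (p (Y.tauInv s) : ℂ) * (Y.val (Y.tauInv s) : ℂ) ^ 4
          * (u.deriv (Y.tauInv s) * conj (u.deriv (Y.tauInv s)))) zero_le_one
  rw [tau_one] at h2
  rw [h1, h2, W21.integral_eq_setIntegral]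
  refine integral_congr_ae ?_
  filter_upwards [ae_restrict_mem measurableSet_Icc] with t ht
  have : (Y.val t : ℂ) ≠ 0 := by exact_mod_cast (Y.val_pos t).ne'
  rw [Y.tauInv_tau ht]
  push_cast
  field_simp

end PositiveFactor

/-! ### Factorization of the quadratic form -/

/-- The factorization identity behind the substitution `y ↦ J (y / Y₁)`: the quadratic forms
differ by boundary terms. -/
theorem quadForm_identity {p : ℝ → ℝ} (hp : UniformlyPositive p) {f : WNeg} {ω : ℝ → ℝ} {ω₁ : ℝ}
    (hω : IsAntiderivative f ω ω₁) {Y : PositiveFactor} {Y₂ : ℝ → ℝ}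
    (hY : IsSystemSolution p ω Y Y₂) (y : W21) :
    ((∫ t in (0 : ℝ)..1, p t * ‖y.deriv t‖ ^ 2 : ℝ) : ℂ) + f (W21.mul y (W21.conjugate y))
      = ((∫ s in (0 : ℝ)..1, Y.JInfty p s * ‖(Y.substitution y).deriv s‖ ^ 2 : ℝ) : ℂ)
        + ((Y₂ 1 / Y.val 1 + ω₁ : ℝ) : ℂ) * (y 1 * conj (y 1))
        - ((Y₂ 0 / Y.val 0 : ℝ) : ℂ) * (y 0 * conj (y 0)) := by
  obtain ⟨hpm, c, hc, hpc⟩ := hp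
  obtain ⟨hωm, hω⟩ := hω
  obtain ⟨hY1, hYint, hY2⟩ := hY
  have h0 : (0 : ℝ) ∈ Icc (0 : ℝ) 1 := by simp
  have h1 : (1 : ℝ) ∈ Icc (0 : ℝ) 1 := by simp
  -- Here `N = |y|²`, `w = |y|² / Y₁` and `g = Y₂'`; the boundary terms come from integrating `(Y₂
  -- w)'`.
  set N := W21.mul y (W21.conjugate y) with hN
  set w := W21.mul Y.inv N with hw
  set g : ℝ → ℂ := fun t => ((-(ω t ^ 2 / p t) * Y.val t - ω t / p t * Y₂ t : ℝ) : ℂ) with hg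
  have hgint : Integrable g μI := by
    have := (intervalIntegrable_iff_integrableOn_Icc_of_le zero_le_one).1 hYint
    exact this.ofReal
  have hY2' : ∀ t ∈ Icc (0 : ℝ) 1, (Y₂ t : ℂ) = (Y₂ 0 : ℂ) + ∫ x in (0 : ℝ)..t, g x := by
    intro t ht
    rw [hY2 t ht, hg, intervalIntegral.integral_ofReal]
    push_cast
    rfl
  obtain ⟨ibi, ib⟩ := W21.integral_by_parts hgint (Y₂ 0 : ℂ) w
  -- The defining identity of `ω` tests against conjugates; `N` is real, so it may be applied to `N`
  -- itself.
  have hconjN : W21.conjugate N = N := by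
    rw [hN, W21.conjugate_mul, W21.conjugate_conjugate, W21.mul_comm]
  have hNd : ∀ᵐ t ∂μI, conj (N.deriv t) = N.deriv t := by
    have := W21.deriv_conjugate N
    rw [hconjN] at this
    filter_upwards [this] with t ht using ht.symm
  have hf : f N = -(∫ t, (ω t : ℂ) * N.deriv t ∂μI) + (ω₁ : ℂ) * (y 1 * conj (y 1)) := by
    have := hω N
    rw [hconjN, W21.integral_eq_setIntegral] at this
    rw [this, hN, W21.mul_apply _ _ h1, W21.conjugate_apply _ h1, ← hN, map_mul, Complex.conj_conj,
      mul_comm (conj (y 1))]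
    congr 2
    refine integral_congr_ae ?_
    filter_upwards [hNd] with t ht
    rw [ht]
  have i1 : Integrable (fun t => (p t : ℂ) * (y.deriv t * conj (y.deriv t))) μI := by
    have := (Lp.memLp y.deriv).star.integrable_mul (W21.memLp_coeff_mul_deriv hpm y)
    refine this.congr (Eventually.of_forall fun t => ?_)
    simp only [Pi.mul_apply, Pi.star_apply, RCLike.star_def]
    ring
  have i2 : Integrable (fun t => (ω t : ℂ) * N.deriv t) μI :=
    MemLp.integrable_mul (hωm.ofReal (K := ℂ)) (Lp.memLp N.deriv)
  have e1 : ((∫ t in (0 : ℝ)..1, p t * ‖y.deriv t‖ ^ 2 : ℝ) : ℂ)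
      = ∫ t, (p t : ℂ) * (y.deriv t * conj (y.deriv t)) ∂μI := by
    rw [← intervalIntegral.integral_ofReal, W21.integral_eq_setIntegral]
    refine integral_congr_ae (Eventually.of_forall fun t => ?_)
    simp only [Complex.mul_conj']
    push_cast
    rfl
  -- With `σ = Y₁'/Y₁` one has `pσ = ω + Y₂/Y₁`. The left side is `p|y' - σy|² = p|y'|² - pσN' +
  -- pσ²N`, while `(Y₂w)' = (Y₂/Y₁)N' - pσ²N`, because `Y₂' = -ωY₁'`.
  have key : ∀ᵐ t ∂μI, (p t : ℂ) * (Y.val t : ℂ) ^ 2 * ((W21.mul Y.inv y).deriv t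
          * conj ((W21.mul Y.inv y).deriv t))
      = (p t : ℂ) * (y.deriv t * conj (y.deriv t)) - (ω t : ℂ) * N.deriv t
        - (g t * w t + ((Y₂ 0 : ℂ) + ∫ x in (0 : ℝ)..t, g x) * w.deriv t) := by
    filter_upwards [ae_restrict_mem measurableSet_Icc, hY1, hpc, W21.deriv_mul Y.inv y,
      W21.deriv_mul Y.inv N, W21.deriv_mul y (W21.conjugate y), W21.deriv_conjugate y,
      Y.deriv_inv] with t ht a1 a2 a3 a4 a5 a6 a7
    have hp0 : (p t : ℂ) ≠ 0 := by exact_mod_cast (hc.trans_le a2).ne'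
    have hv0 : (Y.val t : ℂ) ≠ 0 := by exact_mod_cast (Y.val_pos t).ne'
    have hNt : N t = y t * conj (y t) := by
      rw [hN, W21.mul_apply _ _ ht, W21.conjugate_apply _ ht]
    have hwt : w t = (Y.val t : ℂ)⁻¹ * N t := by
      rw [hw, W21.mul_apply _ _ ht, Y.inv_apply ht, Y.toW21_eq ht]
    rw [← hY2' t ht, hwt, a3, a4, a5, a6, a7, hNt, Y.inv_apply ht, Y.toW21_eq ht,
      W21.conjugate_apply _ ht, a1, hg]
    simp only [map_add, map_mul, map_neg, map_pow, map_inv₀, Complex.conj_ofReal]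
    push_cast
    field_simp
    ring
  have i12 : Integrable (fun t => (p t : ℂ) * (y.deriv t * conj (y.deriv t))
      - (ω t : ℂ) * N.deriv t) μI := i1.sub i2
  rw [e1, hf, Y.integral_deriv_substitution, integral_congr_ae key, integral_sub i12 ibi, integral_sub i1 i2, ib, ← hY2' 1 h1, hw,
    W21.mul_apply _ _ h1, W21.mul_apply _ _ h0, hN, W21.mul_apply _ _ h1, W21.mul_apply _ _ h0,
    W21.conjugate_apply _ h1, W21.conjugate_apply _ h0, Y.inv_apply h1, Y.inv_apply h0,
    Y.toW21_eq h0, Y.toW21_eq h1]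
  push_cast
  ring

/-! ### Boundary conditions and the matrices that encode them -/

section
variable {U : Matrix (Fin 2) (Fin 2) ℂ}

/-- Evaluated at suitable test vectors satisfying the conditions, these two equations determine the
entries of `U`; its diagonal form is thus derived, not assumed. -/
theorem HasBoundaryConditions.equations {C : ℂ → ℂ → ℂ → ℂ → Prop}
    (h : HasBoundaryConditions U C) {y₀ y₁ d₀ d₁ : ℂ} (hC : C y₀ y₁ d₀ d₁) :
    (U 0 0 - 1) * d₀ - U 0 1 * d₁ + Complex.I * ((U 0 0 + 1) * y₀ + U 0 1 * y₁) = 0 ∧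
    U 1 0 * d₀ - (U 1 1 - 1) * d₁ + Complex.I * (U 1 0 * y₀ + (U 1 1 + 1) * y₁) = 0 := by
  have h0 := (h y₀ y₁ d₀ d₁).2 hC
  have e0 := congrFun h0 0
  have e1 := congrFun h0 1
  simp at e0 e1
  constructor
  · linear_combination e0
  · linear_combination e1

theorem matrix_eq_diagonal {a b : ℂ} (h00 : U 0 0 = a) (h01 : U 0 1 = 0) (h10 : U 1 0 = 0)
    (h11 : U 1 1 = b) : U = Matrix.diagonal ![a, b] := by
  ext i j
  fin_cases i <;> fin_cases j <;> simp [h00, h01, h10, h11]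

theorem eq_diagonal_of_dirichlet
    (h : HasBoundaryConditions U (fun y₀ y₁ _ _ => y₀ = 0 ∧ y₁ = 0)) :
    U = Matrix.diagonal ![1, 1] := by
  obtain ⟨a1, a2⟩ := h.equations (y₀ := 0) (y₁ := 0) (d₀ := 1) (d₁ := 0) ⟨rfl, rfl⟩
  obtain ⟨b1, b2⟩ := h.equations (y₀ := 0) (y₁ := 0) (d₀ := 0) (d₁ := 1) ⟨rfl, rfl⟩
  apply matrix_eq_diagonal
  · linear_combination a1
  · linear_combination -b1
  · linear_combination a2
  · linear_combination -b2

theorem eq_diagonal_of_neumann_dirichlet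
    (h : HasBoundaryConditions U (fun _ y₁ d₀ _ => d₀ = 0 ∧ y₁ = 0)) :
    U = Matrix.diagonal ![-1, 1] := by
  obtain ⟨a1, a2⟩ := h.equations (y₀ := 1) (y₁ := 0) (d₀ := 0) (d₁ := 0) ⟨rfl, rfl⟩
  obtain ⟨b1, b2⟩ := h.equations (y₀ := 0) (y₁ := 0) (d₀ := 0) (d₁ := 1) ⟨rfl, rfl⟩
  apply matrix_eq_diagonal
  · linear_combination -Complex.I * a1 + (U 0 0 + 1) * Complex.I_sq
  · linear_combination -b1
  · linear_combination -Complex.I * a2 + U 1 0 * Complex.I_sq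
  · linear_combination -b2

theorem ofReal_add_I_ne_zero (c : ℝ) : (c : ℂ) + Complex.I ≠ 0 := by
  intro h
  simpa using congrArg Complex.im h

theorem eq_diagonal_of_neumann_robin {c : ℝ}
    (h : HasBoundaryConditions U (fun _ y₁ d₀ d₁ => d₀ = 0 ∧ d₁ + (c : ℂ) * y₁ = 0)) :
    ∃ u : ℂ, (u - 1) * c + Complex.I * (u + 1) = 0 ∧ U = Matrix.diagonal ![-1, u] := by
  obtain ⟨a1, a2⟩ := h.equations (y₀ := 1) (y₁ := 0) (d₀ := 0) (d₁ := 0) ⟨rfl, by ring⟩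
  -- The vector `y₁ = 1`, `d₁ = -c` solves the Robin condition. It makes `U 0 1` a solution of `U 0
  -- 1 * (c + i) = 0` and gives the Cayley relation for `U 1 1`.
  obtain ⟨b1, b2⟩ := h.equations (y₀ := 0) (y₁ := 1) (d₀ := 0) (d₁ := -c) ⟨rfl, by ring⟩
  refine ⟨U 1 1, by linear_combination b2, ?_⟩
  apply matrix_eq_diagonal
  · linear_combination -Complex.I * a1 + (U 0 0 + 1) * Complex.I_sq
  · have : U 0 1 * (c + Complex.I) = 0 := by linear_combination b1
    exact (mul_eq_zero.1 this).resolve_right (ofReal_add_I_ne_zero c)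
  · linear_combination -Complex.I * a2 + U 1 0 * Complex.I_sq
  · rfl

/-- The relation says `u = (c - i)/(c + i)`, a quotient of conjugate numbers. -/
theorem cayley_norm {c : ℝ} {u : ℂ} (h : (u - 1) * c + Complex.I * (u + 1) = 0) : ‖u‖ = 1 := by
  have h1 : u * (c + Complex.I) = conj ((c : ℂ) + Complex.I) := by
    rw [map_add, Complex.conj_ofReal, Complex.conj_I]
    linear_combination h
  have h2 := congrArg norm h1
  rw [norm_mul, RCLike.norm_conj] at h2
  exact (mul_eq_right₀ (norm_ne_zero_iff.2 (ofReal_add_I_ne_zero c))).1 h2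

theorem cayley_ne_one {c : ℝ} {u : ℂ} (h : (u - 1) * c + Complex.I * (u + 1) = 0) : u ≠ 1 := by
  rintro rfl
  have := Complex.I_ne_zero
  norm_num at h

/-- The parametrization of the Robin boundary condition by the unit circle. -/
theorem neg_cot_half_arg {c : ℝ} {u : ℂ} (h : (u - 1) * c + Complex.I * (u + 1) = 0) :
    -Real.cot (u.arg / 2) = c := by
  set φ := u.arg / 2 with hφ
  set e := Complex.exp (φ * Complex.I) with he
  have hu : u = e ^ 2 := by
    have h1 := Complex.norm_mul_exp_arg_mul_I u
    rw [cayley_norm h, Complex.ofReal_one, one_mul] at h1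
    refine h1.symm.trans ?_
    rw [he, ← Complex.exp_nat_mul, hφ]
    congr 1
    push_cast
    ring
  have hexp : e = Real.cos φ + Real.sin φ * Complex.I := by
    rw [he, Complex.exp_mul_I]
    push_cast
    rfl
  have hsq : (Real.cos φ : ℂ) ^ 2 + (Real.sin φ : ℂ) ^ 2 = 1 := by
    exact_mod_cast Real.cos_sq_add_sin_sq φ
  -- From `e² - 1 = 2i e sin φ` and `e² + 1 = 2e cos φ`.
  have h1 : e * (2 * Complex.I * (c * Real.sin φ + Real.cos φ)) = 0 := by
    rw [hu, hexp] at h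
    rw [hexp, ← h]
    linear_combination (Complex.I - c) * hsq
      + (c - Complex.I) * (Real.sin φ : ℂ) ^ 2 * Complex.I_sq
  have h2 : c * Real.sin φ + Real.cos φ = 0 := by
    have h3 := (mul_eq_zero.1 h1).resolve_left (Complex.exp_ne_zero _)
    have h4 := (mul_eq_zero.1 h3).resolve_left (by simp)
    exact_mod_cast h4
  have hs : Real.sin φ ≠ 0 := by
    intro hs
    have hc : Real.cos φ = 0 := by rw [hs] at h2; linarith
    have := Real.cos_sq_add_sin_sq φ
    rw [hs, hc] at this
    norm_num at this
  rw [Real.cot_eq_cos_div_sin]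
  field_simp
  linarith

theorem boundaryForm_diagonal (a b : ℂ) (y : W21) :
    star (trace y) ⬝ᵥ (boundaryMatrix (Matrix.diagonal ![a, b])).mulVec (trace y)
      = (open Classical in if a = 1 then 0 else ((-Real.cot (a.arg / 2) : ℝ) : ℂ))
          * (y 0 * conj (y 0))
        + (open Classical in if b = 1 then 0 else ((-Real.cot (b.arg / 2) : ℝ) : ℂ))
          * (y 1 * conj (y 1)) := by
  have t0 : trace y 0 = y 0 := rfl
  have t1 : trace y 1 = y 1 := rfl
  rw [boundaryMatrix]
  simp only [dotProduct, Matrix.mulVec_diagonal, Fin.sum_univ_two, Pi.star_apply, t0, t1,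
    Matrix.diagonal_apply_eq, RCLike.star_def, Matrix.cons_val_zero, Matrix.cons_val_one]
  ring_nf

theorem mem_HU_diagonal {a b : ℂ} {y : W21} :
    y ∈ HU (Matrix.diagonal ![a, b]) ↔ (a = 1 → y 0 = 0) ∧ (b = 1 → y 1 = 0) := by
  rw [mem_HU]
  have hm : ∀ v : Fin 2 → ℂ, (Matrix.diagonal ![a, b] - 1).mulVec v
      = ![(a - 1) * v 0, (b - 1) * v 1] := by
    intro v
    rw [← Matrix.diagonal_one, Matrix.diagonal_sub]
    ext i
    rw [Matrix.mulVec_diagonal]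
    fin_cases i <;> rfl
  constructor
  · rintro ⟨v, hv⟩
    rw [hm] at hv
    have e0 : (a - 1) * v 0 = y 0 := congrFun hv 0
    have e1 : (b - 1) * v 1 = y 1 := congrFun hv 1
    exact ⟨fun ha => by rw [← e0, ha]; ring, fun hb => by rw [← e1, hb]; ring⟩
  · rintro ⟨ha, hb⟩
    have key : ∀ c z : ℂ, (c = 1 → z = 0) → (c - 1) * (z / (c - 1)) = z := by
      intro c z h
      by_cases hc : c = 1
      · rw [h hc]; ring
      · exact mul_div_cancel₀ z (sub_ne_zero.2 hc)
    -- An entry equal to `1` makes the divisor zero, harmlessly: the boundary value vanishes there.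
    refine ⟨![y 0 / (a - 1), y 1 / (b - 1)], ?_⟩
    rw [hm]
    simp only [Matrix.cons_val_zero, Matrix.cons_val_one, key _ _ ha, key _ _ hb]

end

/-- `τ` fixes both endpoints, so the boundary values are only multiplied by the nonzero numbers `1 /
Y₁(0)` and `1 / Y₁(1)`. -/
theorem PositiveFactor.substitution_mem_HU (Y : PositiveFactor) {a b : ℂ} {y : W21} :
    Y.substitution y ∈ HU (Matrix.diagonal ![a, b]) ↔ y ∈ HU (Matrix.diagonal ![a, b]) := by
  have h0 : (Y.val 0 : ℂ) ≠ 0 := by exact_mod_cast (Y.val_pos 0).ne'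
  have h1 : (Y.val 1 : ℂ) ≠ 0 := by exact_mod_cast (Y.val_pos 1).ne'
  rw [mem_HU_diagonal, mem_HU_diagonal, Y.substitution_zero, Y.substitution_one]
  simp [h0, h1]

/-- The transformed boundary conditions: the form domain is preserved, and the boundary terms of
the quadratic forms correspond to each other. -/
theorem boundary_correspondence (Y₁ : PositiveFactor) (Y₂ : ℝ → ℝ) (ω₁ : ℝ)
    (U U' : Matrix (Fin 2) (Fin 2) ℂ)
    (hU :
      (HasBoundaryConditions U (fun y₀ y₁ _ _ => y₀ = 0 ∧ y₁ = 0) ∧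
        HasBoundaryConditions U' (fun y₀ y₁ _ _ => y₀ = 0 ∧ y₁ = 0)) ∨
      (HasBoundaryConditions U (fun _ y₁ d₀ _ => d₀ = 0 ∧ y₁ = 0) ∧ Y₂ 0 = 0 ∧
        HasBoundaryConditions U' (fun _ y₁ d₀ _ => d₀ = 0 ∧ y₁ = 0)) ∨
      (HasBoundaryConditions U (fun _ _ d₀ d₁ => d₀ = 0 ∧ d₁ = 0) ∧ Y₂ 0 = 0 ∧
        HasBoundaryConditions U' (fun _ y₁ d₀ d₁ =>
          d₀ = 0 ∧ d₁ + (((Y₂ 1 / Y₁.val 1 + ω₁) * Y₁.val 1 ^ 2 : ℝ) : ℂ) * y₁ = 0))) :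
    HU U' = HU U ∧ (∀ y, Y₁.substitution y ∈ HU U ↔ y ∈ HU U) ∧
    ∀ y ∈ HU U,
      ((Y₂ 1 / Y₁.val 1 + ω₁ : ℝ) : ℂ) * (y 1 * conj (y 1))
        - ((Y₂ 0 / Y₁.val 0 : ℝ) : ℂ) * (y 0 * conj (y 0))
        + star (trace y) ⬝ᵥ (boundaryMatrix U).mulVec (trace y)
      = star (trace (Y₁.substitution y)) ⬝ᵥ
          (boundaryMatrix U').mulVec (trace (Y₁.substitution y)) := by
  have hm1 : (-1 : ℂ) ≠ 1 := by norm_num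
  rcases hU with ⟨h, h'⟩ | ⟨h, hY, h'⟩ | ⟨h, hY, h'⟩
  · rw [eq_diagonal_of_dirichlet h, eq_diagonal_of_dirichlet h']
    refine ⟨rfl, fun y => Y₁.substitution_mem_HU, fun y hy => ?_⟩
    rw [mem_HU_diagonal] at hy
    rw [boundaryForm_diagonal, boundaryForm_diagonal, hy.1 rfl, hy.2 rfl, if_pos rfl]
    ring
  · rw [eq_diagonal_of_neumann_dirichlet h, eq_diagonal_of_neumann_dirichlet h']
    refine ⟨rfl, fun y => Y₁.substitution_mem_HU, fun y hy => ?_⟩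
    rw [mem_HU_diagonal] at hy
    rw [boundaryForm_diagonal, boundaryForm_diagonal, hy.2 rfl, hY, if_pos rfl, if_neg hm1,
      Complex.arg_neg_one, Real.cot_eq_cos_div_sin, Real.cos_pi_div_two]
    simp
  · have h0 : HasBoundaryConditions U
        (fun _ y₁ d₀ d₁ => d₀ = 0 ∧ d₁ + ((0 : ℝ) : ℂ) * y₁ = 0) := by
      simpa only [Complex.ofReal_zero, zero_mul, add_zero] using h
    obtain ⟨u, hu, hU⟩ := eq_diagonal_of_neumann_robin h0
    obtain ⟨u', hu', hU'⟩ := eq_diagonal_of_neumann_robin h'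
    have hmem : ∀ y, y ∈ HU U := fun y => by
      rw [hU, mem_HU_diagonal]
      exact ⟨fun h => absurd h hm1, fun h => absurd h (cayley_ne_one hu)⟩
    have hmem' : ∀ y, y ∈ HU U' := fun y => by
      rw [hU', mem_HU_diagonal]
      exact ⟨fun h => absurd h hm1, fun h => absurd h (cayley_ne_one hu')⟩
    refine ⟨?_, fun y => iff_of_true (hmem _) (hmem _), fun y _ => ?_⟩
    · ext y; exact iff_of_true (hmem' y) (hmem y)
    -- The factor `Y₁(1)²` in the Robin coefficient offsets `|Sy(1)|² = |y(1)|² / Y₁(1)²`.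
    · have h1 : (Y₁.val 1 : ℂ) ≠ 0 := by exact_mod_cast (Y₁.val_pos 1).ne'
      rw [hU, hU', boundaryForm_diagonal, boundaryForm_diagonal, if_neg hm1,
        if_neg (cayley_ne_one hu), if_neg (cayley_ne_one hu'), neg_cot_half_arg hu,
        neg_cot_half_arg hu', hY, Complex.arg_neg_one, Real.cot_eq_cos_div_sin,
        Real.cos_pi_div_two, Y₁.substitution_one, map_mul, map_inv₀, Complex.conj_ofReal]
      push_cast
      field_simp
      ring

/-- The quadratic form of the transformed problem at `J (y / Y₁)` is that of the original problem
at `y`. -/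
theorem quadForm_substitution {p : ℝ → ℝ} (hp : UniformlyPositive p) {q r : WNeg} {ξ : ℝ}
    {ω : ℝ → ℝ} {ω₁ : ℝ} (hω : IsAntiderivative (q - (ξ : ℂ) • r) ω ω₁)
    {Y₁ : PositiveFactor} {Y₂ : ℝ → ℝ} (hY : IsSystemSolution p ω Y₁ Y₂)
    {U U' : Matrix (Fin 2) (Fin 2) ℂ} {y : W21}
    (hb : ((Y₂ 1 / Y₁.val 1 + ω₁ : ℝ) : ℂ) * (y 1 * conj (y 1))
        - ((Y₂ 0 / Y₁.val 0 : ℝ) : ℂ) * (y 0 * conj (y 0))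
        + star (trace y) ⬝ᵥ (boundaryMatrix U).mulVec (trace y)
      = star (trace (Y₁.substitution y)) ⬝ᵥ
          (boundaryMatrix U').mulVec (trace (Y₁.substitution y))) (lam : ℂ) :
    quadForm U' (Y₁.JInfty p) ((ξ : ℂ) • Y₁.JNeg (WNeg.mul (Y₁.toW21 ^ 4) r)
        - lam • Y₁.JNeg (WNeg.mul (Y₁.toW21 ^ 4) r)) (Y₁.substitution y)
      = quadForm U p (q - lam • r) y := by
  -- Split `q - λr = (q - ξr) + (ξ - λ)r`: the factorization absorbs the first part, and the second
  -- is carried over by `JNeg_substitution`.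
  have key := quadForm_identity hp hω hY y
  rw [quadForm, quadForm, ← hb]
  simp only [sub_apply, smul_apply, smul_eq_mul, Y₁.JNeg_substitution] at key ⊢
  linear_combination -key

end SturmLiouville

end

/-! ### Equivalence of the two pencils -/

theorem mainTheorem4
    (p : ℝ → ℝ) (hp : UniformlyPositive p) (q r : WNeg) (ξ : ℝ)
    (ω : ℝ → ℝ) (ω₁ : ℝ) (hω : IsAntiderivative (q - (ξ : ℂ) • r) ω ω₁)
    (Y₁ : PositiveFactor) (Y₂ : ℝ → ℝ) (hY : IsSystemSolution p ω Y₁ Y₂)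
    (U U' : Matrix (Fin 2) (Fin 2) ℂ)
    (hU :
      (HasBoundaryConditions U (fun y₀ y₁ _ _ => y₀ = 0 ∧ y₁ = 0) ∧
        HasBoundaryConditions U' (fun y₀ y₁ _ _ => y₀ = 0 ∧ y₁ = 0)) ∨
      (HasBoundaryConditions U (fun _ y₁ d₀ _ => d₀ = 0 ∧ y₁ = 0) ∧ Y₂ 0 = 0 ∧
        HasBoundaryConditions U' (fun _ y₁ d₀ _ => d₀ = 0 ∧ y₁ = 0)) ∨
      (HasBoundaryConditions U (fun _ _ d₀ d₁ => d₀ = 0 ∧ d₁ = 0) ∧ Y₂ 0 = 0 ∧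
        HasBoundaryConditions U' (fun _ y₁ d₀ d₁ =>
          d₀ = 0 ∧ d₁ + (((Y₂ 1 / Y₁.val 1 + ω₁) * Y₁.val 1 ^ 2 : ℝ) : ℂ) * y₁ = 0))) :
    HU U' = HU U ∧
    (∃! T : ℂ → HU U →L[ℂ] HUNeg U, IsPencil U p q r T) ∧
    (∃! T' : ℂ → HU U' →L[ℂ] HUNeg U', IsPencil U' (Y₁.JInfty p)
      ((ξ : ℂ) • Y₁.JNeg (WNeg.mul (Y₁.toW21 ^ 4) r)) (Y₁.JNeg (WNeg.mul (Y₁.toW21 ^ 4) r)) T') ∧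
    ∃ S : HU U ≃L[ℂ] HU U',
      (∀ y : HU U, (S y : W21) = Y₁.J (W21.mul Y₁.inv y)) ∧
      ∀ (T : ℂ → HU U →L[ℂ] HUNeg U) (T' : ℂ → HU U' →L[ℂ] HUNeg U'),
        IsPencil U p q r T →
        IsPencil U' (Y₁.JInfty p) ((ξ : ℂ) • Y₁.JNeg (WNeg.mul (Y₁.toW21 ^ 4) r))
          (Y₁.JNeg (WNeg.mul (Y₁.toW21 ^ 4) r)) T' →
        ∀ lam : ℂ,
          ContinuousLinearMap.adjoint (S : HU U →L[ℂ] HU U') ∘L embedPlus U' ∘L T' lam ∘L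
              (S : HU U →L[ℂ] HU U')
            = embedPlus U ∘L T lam := by
  obtain ⟨hHU, hmem, hb⟩ := boundary_correspondence Y₁ Y₂ ω₁ U U' hU
  have hform := fun (y : HU U) => quadForm_substitution hp hω hY (hb y y.2)
  have hmap : (HU U).map (Y₁.substitutionEquiv.toLinearEquiv : W21 →ₗ[ℂ] W21) = HU U' := by
    rw [hHU]
    ext z
    constructor
    · rintro ⟨y, hy, rfl⟩
      exact (hmem y).2 hy
    · intro hz
      obtain ⟨y, rfl⟩ := Y₁.substitutionEquiv.surjective z
      exact ⟨y, (hmem y).1 hz, rfl⟩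
  let S : HU U ≃L[ℂ] HU U' := Y₁.substitutionEquiv.ofSubmodules (HU U) (HU U') hmap
  have hS : ∀ y : HU U, (S y : W21) = Y₁.substitution y := fun y => rfl
  have hT := existsUnique_isPencil U (p := p) (q := q) (r := r)
    (fun lam => exists_operator_quadForm U hp.1 (q - lam • r))
  refine ⟨hHU, hT, existsUnique_isPencil U' fun lam => ?_, S, hS, fun T T' hT hT' lam => ?_⟩
  -- The transformed form is represented by transporting `A` through `S⁻¹`, which avoids verifying
  -- that `J_∞ p` is an element of `L_∞`.
  · obtain ⟨A, hA⟩ := exists_operator_quadForm U hp.1 (q - lam • r)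
    refine ⟨ContinuousLinearMap.adjoint (S.symm : HU U' →L[ℂ] HU U) ∘L A ∘L
      (S.symm : HU U' →L[ℂ] HU U), fun z => ?_⟩
    obtain ⟨y, rfl⟩ := S.surjective z
    rw [ContinuousLinearMap.comp_apply, ContinuousLinearMap.adjoint_inner_right, hS, hform, ← hA]
    simp
  -- Moving `S*` to the other side leaves the form of the transformed pencil at `Sy`.
  · refine operator_ext_quadratic fun y => ?_
    rw [ContinuousLinearMap.comp_apply, ContinuousLinearMap.adjoint_inner_right]
    exact ((isPencil_iff U' _ _ _ T').1 hT' lam (S y)).trans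
      ((congrArg _ (hS y)).trans ((hform y lam).trans ((isPencil_iff U p q r T).1 hT lam y).symm))
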